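/- Let $L_2[0,1]$ and $L_2([0,1]^2)$ be the complex $L_2$ spaces with respect to Lebesgue measure. Let $u,v:[0,1]\to[0,\infty)$ be continuous functions, each of which has a zero in $[0,1]$, and let $k_1,k_2:[0,1]^2\to\mathbb{C}$ be continuous with $k_j(x,s)=\overline{k_j(s,x)}$ for all $x,s$. Assume that the integral operators $$(K_j\varphi)(x)=\int_0^1 k_j(x,s)\varphi(s)\,ds,\qquad j=1,2,$$ on $L_2[0,1]$ are positive, i.e. $(K_j\varphi,\varphi)\ge 0$ for all $\varphi\in L_2[0,1]$. Define the bounded self-adjoint operators $$(H_1\varphi)(x)=u(x)\varphi(x)-(K_1\varphi)(x),\qquad (H_2\varphi)(x)=v(x)\varphi(x)-(K_2\varphi)(x)$$ on $L_2[0,1]$, and $$(Tf)(x,y)=(u(x)+v(y))f(x,y)-\int_0^1 k_1(x,s)f(s,y)\,ds-\int_0^1 k_2(y,t)f(x,t)\,dt$$ on $L_2([0,1]^2)$. For a bounded self-adjoint operator $A$ let $\sigma_d(A)$ denote its discrete spectrum, i.e. the set of isolated points of the spectrum of $A$ that are eigenvalues of finite multiplicity, and let $|\Omega|$ denote the cardinality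 of a set $\Omega$. Then: (a) if $\sigma_d(H_1)=\emptyset$ or $\sigma_d(H_2)=\emptyset$, then $\sigma_d(T)=\emptyset$; (b) if $|\sigma_d(H_1)|>0$ and $|\sigma_d(H_2)|>0$, then $|\sigma_d(T)|>0$; (c) if $|\sigma_d(H_1)|=p$ and $|\sigma_d(H_2)|=q$, where $p,q$ are cardinals (finite or infinite), then $|\sigma_d(T)|\le pq$. -/

import Mathlib

open MeasureTheory

/-- `L₂[0,1]`: complex-valued square integrable functions for Lebesgue measure. -/
noncomputable abbrev L2Interval := Lp ℂ 2 (volume : Measure unitInterval)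

/-- `L₂([0,1]²)`: complex-valued square integrable functions for Lebesgue measure. -/
noncomputable abbrev L2Square := Lp ℂ 2 (volume : Measure (unitInterval × unitInterval))

/-- The discrete spectrum of a bounded operator: the isolated points of the spectrum
that are eigenvalues of finite (geometric) multiplicity. -/
def discreteSpectrum {E : Type*} [NormedAddCommGroup E] [NormedSpace ℂ E]
    (A : E →L[ℂ] E) : Set ℂ :=
  {z | z ∈ spectrum ℂ A ∧ (∃ ε > 0, ∀ w ∈ spectrum ℂ A, dist w z < ε → w = z) ∧
    Module.End.HasEigenvalue (A : E →ₗ[ℂ] E) z ∧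
    FiniteDimensional ℂ (Module.End.eigenspace (A : E →ₗ[ℂ] E) z)}

section Multiplication

variable {X : Type*} [TopologicalSpace X] [MeasurableSpace X]
  {μ : Measure X}

theorem mulFun_aestronglyMeasurable [BorelSpace X] (w : C(X, ℝ)) (f : Lp ℂ 2 μ) :
    AEStronglyMeasurable (fun x => (w x : ℂ) * f x) μ :=
  ((Complex.continuous_ofReal.comp w.continuous).aestronglyMeasurable).mul
    (Lp.aestronglyMeasurable f)

theorem mulFun_bound [CompactSpace X] (w : C(X, ℝ)) (f : Lp ℂ 2 μ) :
    ∀ᵐ x ∂μ, ‖(w x : ℂ) * f x‖ ≤ ‖w‖ * ‖f x‖ := by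
  refine Filter.Eventually.of_forall fun x => ?_
  rw [norm_mul, Complex.norm_real]
  exact mul_le_mul_of_nonneg_right (w.norm_coe_le_norm x) (norm_nonneg _)

theorem mulFun_memLp [CompactSpace X] [BorelSpace X] (w : C(X, ℝ)) (f : Lp ℂ 2 μ) :
    MemLp (fun x => (w x : ℂ) * f x) 2 μ :=
  MemLp.of_le_mul (Lp.memLp f) (mulFun_aestronglyMeasurable w f) (mulFun_bound w f)

/-- Multiplication by a real continuous function `w` in `L₂`: `(M f)(x) = w(x) f(x)`. -/
noncomputable def mulOp [CompactSpace X] [BorelSpace X] (μ : Measure X) (w : C(X, ℝ)) :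
    Lp ℂ 2 μ →L[ℂ] Lp ℂ 2 μ :=
  LinearMap.mkContinuous
    { toFun := fun f => (mulFun_memLp w f).toLp (fun x => (w x : ℂ) * f x)
      map_add' := fun f g => by
        rw [← MemLp.toLp_add]
        refine MemLp.toLp_congr _ _ ?_
        filter_upwards [Lp.coeFn_add f g] with x hx
        simp only [Pi.add_apply] at hx ⊢
        rw [hx]
        ring
      map_smul' := fun c f => by
        rw [RingHom.id_apply, ← MemLp.toLp_const_smul]
        refine MemLp.toLp_congr _ _ ?_
        filter_upwards [Lp.coeFn_smul c f] with x hx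
        simp only [Pi.smul_apply, smul_eq_mul] at hx ⊢
        rw [hx]
        ring }
    ‖w‖
    (fun f => by
      refine Lp.norm_le_mul_norm_of_ae_le_mul ?_
      filter_upwards [(mulFun_memLp w f).coeFn_toLp, mulFun_bound w f] with x hx hb
      simp only [LinearMap.coe_mk, AddHom.coe_mk]
      rw [hx]
      exact hb)

end Multiplication

section Kernels

/-- The function `x ↦ ∫ k(x,s) f(s) ds` on `[0,1]`. -/
noncomputable def kernelFun (k : C(unitInterval × unitInterval, ℂ)) (f : unitInterval → ℂ) :
    unitInterval → ℂ :=
  fun x => ∫ s, k (x, s) * f s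

/-- The function `(x,y) ↦ ∫ k(x,s) f(s,y) ds` on `[0,1]²`. -/
noncomputable def kernelFunFst (k : C(unitInterval × unitInterval, ℂ))
    (f : unitInterval × unitInterval → ℂ) : unitInterval × unitInterval → ℂ :=
  fun p => ∫ s, k (p.1, s) * f (s, p.2)

/-- The function `(x,y) ↦ ∫ k(y,t) f(x,t) dt` on `[0,1]²`. -/
noncomputable def kernelFunSnd (k : C(unitInterval × unitInterval, ℂ))
    (f : unitInterval × unitInterval → ℂ) : unitInterval × unitInterval → ℂ :=
  fun p => ∫ t, k (p.2, t) * f (p.1, t)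

theorem eLpNorm_two_sq {X : Type*} [MeasurableSpace X] (μ : Measure X) (f : X → ℂ) :
    eLpNorm f 2 μ ^ 2 = ∫⁻ x, ‖f x‖ₑ ^ 2 ∂μ := by
  have h := eLpNorm_nnreal_pow_eq_lintegral (f := f) (μ := μ) (p := 2) two_ne_zero
  simpa using h

theorem kernelFun_enorm_le (k : C(unitInterval × unitInterval, ℂ)) {f : unitInterval → ℂ}
    (hf : AEStronglyMeasurable f) (x : unitInterval) :
    ‖∫ s, k (x, s) * f s‖ₑ ≤ ‖k‖ₑ * eLpNorm f 2 volume := by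
  calc ‖∫ s, k (x, s) * f s‖ₑ ≤ ∫⁻ s, ‖k (x, s) * f s‖ₑ := enorm_integral_le_lintegral_enorm _
    _ ≤ ∫⁻ s, ‖k‖ₑ * ‖f s‖ₑ := by
        refine lintegral_mono fun s => ?_
        rw [enorm_mul]
        gcongr
        exact enorm_le_iff_norm_le.2 (k.norm_coe_le_norm _)
    _ = ‖k‖ₑ * eLpNorm f 1 volume := by
        rw [lintegral_const_mul' _ _ enorm_ne_top, eLpNorm_one_eq_lintegral_enorm]
    _ ≤ ‖k‖ₑ * eLpNorm f 2 volume := by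
        gcongr
        exact eLpNorm_le_eLpNorm_of_exponent_le (by norm_num) hf

theorem kernel_integrable (k : C(unitInterval × unitInterval, ℂ)) {f : unitInterval → ℂ}
    (hf : MemLp f 2) (x : unitInterval) : Integrable (fun s => k (x, s) * f s) := by
  refine (hf.integrable (by norm_num)).bdd_mul (c := ‖k‖) ?_ ?_
  · exact (k.continuous.comp (by fun_prop)).aestronglyMeasurable
  · exact Filter.Eventually.of_forall fun s => k.norm_coe_le_norm _

theorem kernelFun_congr (k : C(unitInterval × unitInterval, ℂ)) {f g : unitInterval → ℂ}
    (h : f =ᵐ[volume] g) : kernelFun k f = kernelFun k g := by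
  funext x
  refine integral_congr_ae ?_
  filter_upwards [h] with s hs
  rw [hs]

theorem kernelFun_add (k : C(unitInterval × unitInterval, ℂ)) {f g : unitInterval → ℂ}
    (hf : MemLp f 2) (hg : MemLp g 2) :
    kernelFun k (f + g) = kernelFun k f + kernelFun k g := by
  funext x
  simp only [kernelFun, Pi.add_apply, mul_add]
  exact integral_add (kernel_integrable k hf x) (kernel_integrable k hg x)

theorem kernelFun_smul (k : C(unitInterval × unitInterval, ℂ)) (c : ℂ) (f : unitInterval → ℂ) :
    kernelFun k (c • f) = c • kernelFun k f := by
  funext x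
  simp only [kernelFun, Pi.smul_apply, smul_eq_mul]
  rw [← integral_const_mul]
  congr 1
  funext s
  ring

theorem kernelFun_eLpNorm_le (k : C(unitInterval × unitInterval, ℂ)) {f : unitInterval → ℂ}
    (hf : AEStronglyMeasurable f) :
    eLpNorm (kernelFun k f) 2 volume ≤ ‖k‖ₑ * eLpNorm f 2 volume := by
  have h := eLpNorm_mono_enorm (μ := (volume : Measure unitInterval)) (p := 2)
    (f := kernelFun k f) (g := fun _ => ‖k‖ₑ * eLpNorm f 2 volume)
    (fun x => by rw [enorm_eq_self]; exact kernelFun_enorm_le k hf x)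
  refine h.trans ?_
  rw [eLpNorm_const _ (by norm_num) (NeZero.ne _)]
  simp

theorem kernelFun_memLp (k : C(unitInterval × unitInterval, ℂ)) {f : unitInterval → ℂ}
    (hf : MemLp f 2) : MemLp (kernelFun k f) 2 := by
  refine ⟨?_, (kernelFun_eLpNorm_le k hf.1).trans_lt (ENNReal.mul_lt_top enorm_lt_top hf.2)⟩
  have : AEStronglyMeasurable (fun p : unitInterval × unitInterval => k p * f p.2)
      ((volume : Measure unitInterval).prod volume) :=
    k.continuous.aestronglyMeasurable.mul hf.1.comp_snd
  exact this.integral_prod_right'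

theorem kernelFunSnd_congr (k : C(unitInterval × unitInterval, ℂ))
    {f g : unitInterval × unitInterval → ℂ} (h : f =ᵐ[volume] g) :
    kernelFunSnd k f =ᵐ[volume] kernelFunSnd k g := by
  have h1 : ∀ᵐ x : unitInterval, ∀ᵐ t : unitInterval, f (x, t) = g (x, t) :=
    Measure.ae_ae_of_ae_prod h
  have h2 : ∀ᵐ p : unitInterval × unitInterval, ∀ᵐ t : unitInterval,
      f (p.1, t) = g (p.1, t) :=
    Measure.quasiMeasurePreserving_fst.ae h1
  filter_upwards [h2] with p hp
  refine integral_congr_ae ?_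
  filter_upwards [hp] with t ht
  rw [ht]

theorem slice_memLp {f : unitInterval × unitInterval → ℂ} (hf : MemLp f 2) :
    ∀ᵐ p : unitInterval × unitInterval, MemLp (fun t => f (p.1, t)) 2 := by
  have h1 : ∀ᵐ x : unitInterval, AEStronglyMeasurable (fun t : unitInterval => f (x, t)) :=
    AEStronglyMeasurable.prodMk_left hf.1
  have hm : AEMeasurable (fun p => ‖f p‖ₑ ^ 2)
      ((volume : Measure unitInterval).prod (volume : Measure unitInterval)) :=
    hf.1.enorm.pow_const 2
  have h2 : ∀ᵐ x : unitInterval, ∫⁻ t : unitInterval, ‖f (x, t)‖ₑ ^ 2 < ⊤ := by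
    refine ae_lt_top' hm.lintegral_prod_right' ?_
    rw [← lintegral_prod _ hm, ← Measure.volume_eq_prod, ← eLpNorm_two_sq]
    exact ENNReal.pow_ne_top hf.2.ne
  have h3 : ∀ᵐ x : unitInterval, MemLp (fun t : unitInterval => f (x, t)) 2 := by
    filter_upwards [h1, h2] with x hx1 hx2
    refine ⟨hx1, ?_⟩
    rw [← eLpNorm_two_sq volume (fun t => f (x, t))] at hx2
    exact (ENNReal.pow_lt_top_iff.1 hx2).resolve_right two_ne_zero
  exact Measure.quasiMeasurePreserving_fst.ae h3

theorem kernelFunSnd_add (k : C(unitInterval × unitInterval, ℂ))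
    {f g : unitInterval × unitInterval → ℂ} (hf : MemLp f 2) (hg : MemLp g 2) :
    kernelFunSnd k (f + g) =ᵐ[volume] kernelFunSnd k f + kernelFunSnd k g := by
  filter_upwards [slice_memLp hf, slice_memLp hg] with p hp1 hp2
  simp only [kernelFunSnd, Pi.add_apply, mul_add]
  exact integral_add (kernel_integrable k hp1 p.2) (kernel_integrable k hp2 p.2)

theorem kernelFunSnd_smul (k : C(unitInterval × unitInterval, ℂ)) (c : ℂ)
    (f : unitInterval × unitInterval → ℂ) :
    kernelFunSnd k (c • f) = c • kernelFunSnd k f := by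
  funext p
  simp only [kernelFunSnd, Pi.smul_apply, smul_eq_mul]
  rw [← integral_const_mul]
  congr 1
  funext s
  ring

theorem kernelFunSnd_eLpNorm_le (k : C(unitInterval × unitInterval, ℂ))
    {f : unitInterval × unitInterval → ℂ} (hf : MemLp f 2) :
    eLpNorm (kernelFunSnd k f) 2 volume ≤ ‖k‖ₑ * eLpNorm f 2 volume := by
  have hm : AEMeasurable (fun p => ‖f p‖ₑ ^ 2)
      ((volume : Measure unitInterval).prod (volume : Measure unitInterval)) :=
    hf.1.enorm.pow_const 2
  refine (ENNReal.pow_le_pow_left_iff two_ne_zero).1 ?_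
  rw [mul_pow, eLpNorm_two_sq, eLpNorm_two_sq]
  calc ∫⁻ p, ‖kernelFunSnd k f p‖ₑ ^ 2
      ≤ ∫⁻ p : unitInterval × unitInterval, ‖k‖ₑ ^ 2 * ∫⁻ t, ‖f (p.1, t)‖ₑ ^ 2 := by
        refine lintegral_mono_ae ?_
        filter_upwards [slice_memLp hf] with p hp
        rw [← eLpNorm_two_sq volume (fun t => f (p.1, t)), ← mul_pow]
        gcongr
        exact kernelFun_enorm_le k hp.1 p.2
    _ = ‖k‖ₑ ^ 2 * ∫⁻ p, ‖f p‖ₑ ^ 2 := by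
        rw [lintegral_const_mul' _ _ (ENNReal.pow_ne_top enorm_ne_top), Measure.volume_eq_prod,
          lintegral_prod _ hm, lintegral_prod]
        · simp
        · exact hm.lintegral_prod_right'.comp_quasiMeasurePreserving
            Measure.quasiMeasurePreserving_fst

theorem kernelFunSnd_memLp (k : C(unitInterval × unitInterval, ℂ))
    {f : unitInterval × unitInterval → ℂ} (hf : MemLp f 2) : MemLp (kernelFunSnd k f) 2 := by
  refine ⟨?_, (kernelFunSnd_eLpNorm_le k hf).trans_lt (ENNReal.mul_lt_top enorm_lt_top hf.2)⟩
  refine AEStronglyMeasurable.congr ?_ (kernelFunSnd_congr k hf.1.ae_eq_mk.symm)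
  have : StronglyMeasurable (fun q : (unitInterval × unitInterval) × unitInterval =>
      k (q.1.2, q.2) * hf.1.mk f (q.1.1, q.2)) :=
    (k.continuous.stronglyMeasurable.comp_measurable (by fun_prop)).mul
      (hf.1.stronglyMeasurable_mk.comp_measurable (by fun_prop))
  exact this.integral_prod_right'.aestronglyMeasurable

theorem swap_measurePreserving : MeasurePreserving
    (Prod.swap : unitInterval × unitInterval → unitInterval × unitInterval) volume volume :=
  Measure.measurePreserving_swap

theorem memLp_swap {f : unitInterval × unitInterval → ℂ} (hf : MemLp f 2) :
    MemLp (f ∘ Prod.swap) 2 :=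
  hf.comp_measurePreserving swap_measurePreserving

theorem kernelFunFst_eq_swap (k : C(unitInterval × unitInterval, ℂ))
    (f : unitInterval × unitInterval → ℂ) :
    kernelFunFst k f = kernelFunSnd k (f ∘ Prod.swap) ∘ Prod.swap := rfl

theorem kernelFunFst_congr (k : C(unitInterval × unitInterval, ℂ))
    {f g : unitInterval × unitInterval → ℂ} (h : f =ᵐ[volume] g) :
    kernelFunFst k f =ᵐ[volume] kernelFunFst k g :=
  swap_measurePreserving.quasiMeasurePreserving.ae_eq_comp
    (kernelFunSnd_congr k (swap_measurePreserving.quasiMeasurePreserving.ae_eq_comp h))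

theorem kernelFunFst_add (k : C(unitInterval × unitInterval, ℂ))
    {f g : unitInterval × unitInterval → ℂ} (hf : MemLp f 2) (hg : MemLp g 2) :
    kernelFunFst k (f + g) =ᵐ[volume] kernelFunFst k f + kernelFunFst k g :=
  swap_measurePreserving.quasiMeasurePreserving.ae_eq_comp
    (kernelFunSnd_add k (memLp_swap hf) (memLp_swap hg))

theorem kernelFunFst_smul (k : C(unitInterval × unitInterval, ℂ)) (c : ℂ)
    (f : unitInterval × unitInterval → ℂ) :
    kernelFunFst k (c • f) = c • kernelFunFst k f := by
  have h := kernelFunSnd_smul k c (f ∘ Prod.swap)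
  exact congrArg (fun g => g ∘ Prod.swap) h

theorem kernelFunFst_memLp (k : C(unitInterval × unitInterval, ℂ))
    {f : unitInterval × unitInterval → ℂ} (hf : MemLp f 2) : MemLp (kernelFunFst k f) 2 :=
  memLp_swap (kernelFunSnd_memLp k (memLp_swap hf))

theorem kernelFunFst_eLpNorm_le (k : C(unitInterval × unitInterval, ℂ))
    {f : unitInterval × unitInterval → ℂ} (hf : MemLp f 2) :
    eLpNorm (kernelFunFst k f) 2 volume ≤ ‖k‖ₑ * eLpNorm f 2 volume := by
  rw [kernelFunFst_eq_swap, eLpNorm_comp_measurePreserving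
    (kernelFunSnd_memLp k (memLp_swap hf)).1 swap_measurePreserving]
  refine (kernelFunSnd_eLpNorm_le k (memLp_swap hf)).trans_eq ?_
  rw [eLpNorm_comp_measurePreserving hf.1 swap_measurePreserving]

theorem toLp_norm_le {X : Type*} [MeasurableSpace X] {μ : Measure X} {C : ℝ} (hC : 0 ≤ C)
    {g : X → ℂ} (hg : MemLp g 2 μ) (f : Lp ℂ 2 μ)
    (h : eLpNorm g 2 μ ≤ ENNReal.ofReal C * eLpNorm f 2 μ) : ‖hg.toLp g‖ ≤ C * ‖f‖ := by
  rw [Lp.norm_toLp, Lp.norm_def, ← ENNReal.toReal_ofReal hC, ← ENNReal.toReal_mul]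
  exact ENNReal.toReal_mono
    (ENNReal.mul_ne_top ENNReal.ofReal_ne_top (Lp.eLpNorm_ne_top f)) h

/-- The integral operator in `L₂[0,1]`: `(K f)(x) = ∫ k(x,s) f(s) ds`. -/
noncomputable def kernelOp (k : C(unitInterval × unitInterval, ℂ)) :
    L2Interval →L[ℂ] L2Interval :=
  LinearMap.mkContinuous
    { toFun := fun f => (kernelFun_memLp k (Lp.memLp f)).toLp (kernelFun k f)
      map_add' := fun f g => by
        rw [← MemLp.toLp_add]
        refine MemLp.toLp_congr _ _ (Filter.EventuallyEq.of_eq ?_)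
        rw [kernelFun_congr k (Lp.coeFn_add f g), kernelFun_add k (Lp.memLp f) (Lp.memLp g)]
      map_smul' := fun c f => by
        rw [RingHom.id_apply, ← MemLp.toLp_const_smul]
        refine MemLp.toLp_congr _ _ (Filter.EventuallyEq.of_eq ?_)
        rw [kernelFun_congr k (Lp.coeFn_smul c f), kernelFun_smul] }
    ‖k‖
    (fun f => toLp_norm_le (norm_nonneg k) (kernelFun_memLp k (Lp.memLp f)) f (by
      rw [ofReal_norm]
      exact kernelFun_eLpNorm_le k (Lp.memLp f).1))

/-- The partial integral operator in `L₂([0,1]²)` in the first variable: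
`(T₁ f)(x,y) = ∫∫ k(x,s) δ(y-t) f(s,t) ds dt = ∫ k(x,s) f(s,y) ds`. -/
noncomputable def kernelOpFst (k : C(unitInterval × unitInterval, ℂ)) :
    L2Square →L[ℂ] L2Square :=
  LinearMap.mkContinuous
    { toFun := fun f => (kernelFunFst_memLp k (Lp.memLp f)).toLp (kernelFunFst k f)
      map_add' := fun f g => by
        rw [← MemLp.toLp_add]
        refine MemLp.toLp_congr _ _ ?_
        exact (kernelFunFst_congr k (Lp.coeFn_add f g)).trans
          (kernelFunFst_add k (Lp.memLp f) (Lp.memLp g))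
      map_smul' := fun c f => by
        rw [RingHom.id_apply, ← MemLp.toLp_const_smul]
        refine MemLp.toLp_congr _ _ ?_
        exact (kernelFunFst_congr k (Lp.coeFn_smul c f)).trans
          (Filter.EventuallyEq.of_eq (kernelFunFst_smul k c f)) }
    ‖k‖
    (fun f => toLp_norm_le (norm_nonneg k) (kernelFunFst_memLp k (Lp.memLp f)) f (by
      rw [ofReal_norm]
      exact kernelFunFst_eLpNorm_le k (Lp.memLp f)))

/-- The partial integral operator in `L₂([0,1]²)` in the second variable:
`(T₂ f)(x,y) = ∫∫ k(y,t) δ(x-s) f(s,t) ds dt = ∫ k(y,t) f(x,t) dt`. -/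
noncomputable def kernelOpSnd (k : C(unitInterval × unitInterval, ℂ)) :
    L2Square →L[ℂ] L2Square :=
  LinearMap.mkContinuous
    { toFun := fun f => (kernelFunSnd_memLp k (Lp.memLp f)).toLp (kernelFunSnd k f)
      map_add' := fun f g => by
        rw [← MemLp.toLp_add]
        refine MemLp.toLp_congr _ _ ?_
        exact (kernelFunSnd_congr k (Lp.coeFn_add f g)).trans
          (kernelFunSnd_add k (Lp.memLp f) (Lp.memLp g))
      map_smul' := fun c f => by
        rw [RingHom.id_apply, ← MemLp.toLp_const_smul]
        refine MemLp.toLp_congr _ _ ?_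
        exact (kernelFunSnd_congr k (Lp.coeFn_smul c f)).trans
          (Filter.EventuallyEq.of_eq (kernelFunSnd_smul k c f)) }
    ‖k‖
    (fun f => toLp_norm_le (norm_nonneg k) (kernelFunSnd_memLp k (Lp.memLp f)) f (by
      rw [ofReal_norm]
      exact kernelFunSnd_eLpNorm_le k (Lp.memLp f)))

end Kernels

/-- The Friedrichs model operator `H = U - K` in `L₂[0,1]`, where `U` is multiplication by `u`
and `K` is the integral operator with kernel `k`. -/
noncomputable def friedrichsOp (u : C(unitInterval, ℝ)) (k : C(unitInterval × unitInterval, ℂ)) :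
    L2Interval →L[ℂ] L2Interval :=
  mulOp volume u - kernelOp k

/-- The function `(x,y) ↦ u(x) + v(y)` on `[0,1]²`. -/
def sumPotential (u v : C(unitInterval, ℝ)) : C(unitInterval × unitInterval, ℝ) where
  toFun := fun p => u p.1 + v p.2
  continuous_toFun := by fun_prop

/-- The three-particle model operator `T = T₀ - (T₁ + T₂)` in `L₂([0,1]²)`, where `T₀` is
multiplication by `u(x) + v(y)`. -/
noncomputable def threeParticleOp (u v : C(unitInterval, ℝ))
    (k₁ k₂ : C(unitInterval × unitInterval, ℂ)) : L2Square →L[ℂ] L2Square :=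
  mulOp volume (sumPotential u v) - (kernelOpFst k₁ + kernelOpSnd k₂)

/-! ### Self-adjoint operators: isolated spectral points and isolated minima of the form -/

section HilbertSpace

/-! Identify `L₂([0,1]²)` with the Hilbert tensor square of `L₂[0,1]`. Then T = A + B with A = H₁ ⊗
1 and B = 1 ⊗ H₂, and A, B commute.

Parts (a) and (c) both follow from σ_d(T) ⊆ σ_d(H₁) + σ_d(H₂)
(`IsHilbertTensor.exists_add_of_mem_discreteSpectrum`). The eigenspace of T at z ∈ σ_d(T) is
finite-dimensional and A-invariant, so it contains a common eigenvector of A and B, with eigenvalues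
a and z - a. Partial inner products (slices) of it are eigenvectors of H₁ and H₂. Tensoring with a
fixed eigenvector of one factor embeds a shifted copy of the other factor in T, so isolation and
finite multiplicity descend from T to each factor.

For (b), the range of u is the whole interval [0, max u], and by a Weyl-type argument it contains no
point of σ_d(H₁). Since K₁ ≥ 0, no eigenvalue of H₁ exceeds max u; hence a point of σ_d(H₁) is
negative. As K₁ is compact and u ≥ 0, the bottom of the spectrum of H₁ is then an isolated
eigenvalue of finite multiplicity (`exists_isIsolatedBottom_friedrichsOp`); likewise for H₂. The sum
of the two bottoms is an isolated bottom of T (`IsHilbertTensor.isIsolatedBottom_add`). -/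

theorem re_inner_self_complex {E : Type*} [NormedAddCommGroup E] [InnerProductSpace ℂ E] (x : E) :
    (inner ℂ x x).re = ‖x‖ ^ 2 :=
  inner_self_eq_norm_sq (𝕜 := ℂ) x

theorem norm_mul_le_of_re_inner {E : Type*} [NormedAddCommGroup E]
    [InnerProductSpace ℂ E] {x y : E} {c : ℝ} (h : c * ‖x‖ ^ 2 ≤ (inner ℂ y x).re) :
    c * ‖x‖ ≤ ‖y‖ := by
  rcases eq_or_ne x 0 with rfl | hx
  · simp
  · have h1 : (inner ℂ y x).re ≤ ‖y‖ * ‖x‖ := re_inner_le_norm (𝕜 := ℂ) y x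
    have h2 : 0 < ‖x‖ := norm_pos_iff.2 hx
    nlinarith

theorem mem_eigenspace_clm {E : Type*} [NormedAddCommGroup E] [NormedSpace ℂ E]
    {X : E →L[ℂ] E} {z : ℂ} {x : E} :
    x ∈ Module.End.eigenspace (X : E →ₗ[ℂ] E) z ↔ X x = z • x := by
  rw [Module.End.mem_eigenspace_iff]
  rfl

variable {E : Type*} [NormedAddCommGroup E] [InnerProductSpace ℂ E] [CompleteSpace E]

open scoped InnerProductSpace

theorem IsSelfAdjoint.clm_inner_left {X : E →L[ℂ] E} (hX : IsSelfAdjoint X) (x y : E) :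
    ⟪X x, y⟫_ℂ = ⟪x, X y⟫_ℂ :=
  hX.isSymmetric x y

/-- The lower bound gives injectivity and closed range. The range is dense because a vector x
orthogonal to it satisfies ⟪X (X x), x⟫ = ‖X x‖² = 0. -/
theorem IsSelfAdjoint.isUnit_of_le_norm {X : E →L[ℂ] E} (hX : IsSelfAdjoint X) {c : ℝ}
    (hc : 0 < c) (h : ∀ x, c * ‖x‖ ≤ ‖X x‖) : IsUnit X := by
  rw [ContinuousLinearMap.isUnit_iff_bijective,
    ContinuousLinearMap.bijective_iff_dense_range_and_antilipschitz]
  constructor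
  · rw [Submodule.topologicalClosure_eq_top_iff, Submodule.eq_bot_iff]
    intro x hx
    have h1 : ⟪X (X x), x⟫_ℂ = 0 := hx _ ⟨_, rfl⟩
    rw [hX.clm_inner_left, inner_self_eq_zero] at h1
    have h2 := h x
    rw [h1, norm_zero] at h2
    exact norm_le_zero_iff.1 (nonpos_of_mul_nonpos_right h2 hc)
  · refine ⟨⟨c⁻¹, (inv_pos.2 hc).le⟩, X.antilipschitz_of_bound fun x => ?_⟩
    change ‖x‖ ≤ c⁻¹ * ‖X x‖
    rw [inv_mul_eq_div, le_div_iff₀ hc, mul_comm]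
    exact h x

theorem isSelfAdjoint_algebraMap_ofReal (r : ℝ) :
    IsSelfAdjoint (algebraMap ℂ (E →L[ℂ] E) (r : ℂ)) := by
  rw [isSelfAdjoint_iff, ← algebraMap_star_comm]
  simp

theorem IsSelfAdjoint.notMem_spectrum_of_le_norm {X : E →L[ℂ] E} (hX : IsSelfAdjoint X)
    {r c : ℝ} (hc : 0 < c) (h : ∀ x, c * ‖x‖ ≤ ‖X x - (r : ℂ) • x‖) :
    (r : ℂ) ∉ spectrum ℂ X := by
  rw [spectrum.notMem_iff]
  refine ((isSelfAdjoint_algebraMap_ofReal r).sub hX).isUnit_of_le_norm hc fun x => ?_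
  rw [sub_apply, norm_sub_rev]
  simpa [Algebra.algebraMap_eq_smul_one] using h x

/-- If `z` is isolated in the spectrum of a self-adjoint `X`, then `X - z` is invertible modulo
an operator with values in the eigenspace. -/
theorem IsSelfAdjoint.exists_inverse_mod_eigenspace {X : E →L[ℂ] E} (hX : IsSelfAdjoint X)
    {z : ℂ} (hz : ∃ ε > 0, ∀ w ∈ spectrum ℂ X, dist w z < ε → w = z) :
    ∃ R Q : E →L[ℂ] E, (∀ x, R (X x - z • x) + Q x = x) ∧ ∀ x, X (Q x) = z • Q x := by
  classical
  obtain ⟨ε, hε, hz⟩ := hz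
  have : IsStarNormal X := hX.isStarNormal
  -- On the spectrum g(w)(w - z) + q(w) = 1 and (w - z)q(w) = 0. Isolation of z is what makes g and
  -- q continuous there, so the functional calculus turns these identities into operator identities.
  let g : ℂ → ℂ := fun w => if w = z then 0 else (w - z)⁻¹
  let q : ℂ → ℂ := fun w => if w = z then 1 else 0
  have key : ∀ f : ℂ → ℂ, ContinuousOn f {z}ᶜ → ContinuousOn f (spectrum ℂ X) := by
    intro f hf w hw
    by_cases hwz : w = z
    · subst hwz
      refine (continuousWithinAt_singleton (f := f) (x := w)).mono_of_mem_nhdsWithin ?_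
      filter_upwards [inter_mem_nhdsWithin _ (Metric.ball_mem_nhds w hε)] with y hy
      exact hz y hy.1 hy.2
    · exact ((hf.continuousAt (isOpen_compl_singleton.mem_nhds hwz))).continuousWithinAt
  have hg : ContinuousOn g (spectrum ℂ X) := by
    refine key g (ContinuousOn.congr (f := fun w => (w - z)⁻¹) ?_ fun w hw => if_neg hw)
    exact ContinuousOn.inv₀ (by fun_prop) fun w hw => sub_ne_zero.2 hw
  have hq : ContinuousOn q (spectrum ℂ X) :=
    key q ((continuousOn_const (c := (0 : ℂ))).congr fun w hw => if_neg hw)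
  have hXz : cfc (fun w : ℂ => w - z) X = X - algebraMap ℂ _ z := by
    rw [cfc_sub (fun w : ℂ => w) (fun _ => z) X, cfc_id' ℂ X, cfc_const z X]
  refine ⟨cfc g X, cfc q X, fun x => ?_, fun x => ?_⟩
  · have h1 : cfc g X * (X - algebraMap ℂ _ z) + cfc q X = 1 := by
      rw [← hXz, ← cfc_mul g _ X hg (by fun_prop), ← cfc_add X _ q, ← cfc_const_one ℂ X]
      refine cfc_congr fun w _ => ?_
      by_cases hwz : w = z
      · simp [g, q, hwz]
      · simp [g, q, hwz, sub_ne_zero.2 hwz]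
    simpa [Algebra.algebraMap_eq_smul_one] using congrArg (fun Y : E →L[ℂ] E => Y x) h1
  · have h1 : (X - algebraMap ℂ _ z) * cfc q X = 0 := by
      rw [← hXz, ← cfc_mul _ q X (by fun_prop) hq, ← cfc_zero ℂ X]
      refine cfc_congr fun w _ => ?_
      by_cases hwz : w = z <;> simp [q, hwz]
    have h2 := congrArg (fun Y : E →L[ℂ] E => Y x) h1
    simpa [Algebra.algebraMap_eq_smul_one, sub_eq_zero] using h2

/-- `a` is the minimum of the quadratic form of `X`, attained on a finite-dimensional eigenspace,
and the form is at least `a + δ` on the orthogonal complement of that eigenspace. -/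
structure IsIsolatedBottom (X : E →L[ℂ] E) (a δ : ℝ) : Prop where
  pos : 0 < δ
  le : ∀ x, a * ‖x‖ ^ 2 ≤ (⟪X x, x⟫_ℂ).re
  gap : ∀ x ∈ (Module.End.eigenspace (X : E →ₗ[ℂ] E) (a : ℂ))ᗮ,
    (a + δ) * ‖x‖ ^ 2 ≤ (⟪X x, x⟫_ℂ).re
  ne_bot : Module.End.eigenspace (X : E →ₗ[ℂ] E) (a : ℂ) ≠ ⊥
  finite : FiniteDimensional ℂ (Module.End.eigenspace (X : E →ₗ[ℂ] E) (a : ℂ))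

theorem IsSelfAdjoint.apply_mem_eigenspace_orthogonal {X : E →L[ℂ] E} (hX : IsSelfAdjoint X)
    {z : ℂ} {x : E} (hx : x ∈ (Module.End.eigenspace (X : E →ₗ[ℂ] E) z)ᗮ) :
    X x ∈ (Module.End.eigenspace (X : E →ₗ[ℂ] E) z)ᗮ := by
  intro y hy
  rw [← hX.clm_inner_left, mem_eigenspace_clm.1 hy, inner_smul_left, hx y hy, mul_zero]

/-- For real r ≠ a with |r - a| < δ, the operator X - r is the scalar a - r on the eigenspace and
has form at least a + δ - r on its complement. Both pieces are invariant, so by Pythagoras X - r is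
bounded below by the smaller of |r - a| and a + δ - r, hence invertible. -/
theorem IsIsolatedBottom.mem_discreteSpectrum {X : E →L[ℂ] E} {a δ : ℝ} (hX : IsSelfAdjoint X)
    (h : IsIsolatedBottom X a δ) : (a : ℂ) ∈ discreteSpectrum X := by
  have := h.finite
  have hev : Module.End.HasEigenvalue (X : E →ₗ[ℂ] E) (a : ℂ) := h.ne_bot
  refine ⟨?_, ⟨δ, h.pos, fun w hw hwa => ?_⟩, hev, h.finite⟩
  · rw [ContinuousLinearMap.spectrum_eq]
    exact hev.mem_spectrum
  obtain ⟨r, rfl⟩ : ∃ r : ℝ, w = r := ⟨w.re, hX.mem_spectrum_eq_re hw⟩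
  rw [Complex.dist_of_im_eq (by simp), Real.dist_eq] at hwa
  simp only [Complex.ofReal_re] at hwa
  by_contra hne
  have hne' : r ≠ a := fun h => hne (by rw [h])
  have hra : 0 < |r - a| := abs_pos.2 (sub_ne_zero.2 hne')
  have hc : 0 < min |r - a| (a + δ - r) := lt_min hra (by linarith [le_abs_self (r - a)])
  refine hX.notMem_spectrum_of_le_norm hc (fun x => ?_) hw
  set S := Module.End.eigenspace (X : E →ₗ[ℂ] E) (a : ℂ)
  obtain ⟨s, hs, y, hy, rfl⟩ := S.exists_add_mem_mem_orthogonal x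
  set c := min |r - a| (a + δ - r)
  have h1 : c * ‖y‖ ≤ ‖X y - (r : ℂ) • y‖ := by
    refine norm_mul_le_of_re_inner ?_
    have h2 := h.gap y hy
    have h3 : (⟪X y - (r : ℂ) • y, y⟫_ℂ).re = (⟪X y, y⟫_ℂ).re - r * ‖y‖ ^ 2 := by
      rw [inner_sub_left, inner_smul_left, inner_self_eq_norm_sq_to_K]
      simp [← Complex.ofReal_pow]
    have h4 : c ≤ a + δ - r := min_le_right _ _
    rw [h3]
    nlinarith [sq_nonneg ‖y‖]
  have h2 : X (s + y) - (r : ℂ) • (s + y) = ((a - r : ℝ) : ℂ) • s + (X y - (r : ℂ) • y) := by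
    rw [map_add, mem_eigenspace_clm.1 hs]
    push_cast
    module
  have h3 : ‖((a - r : ℝ) : ℂ) • s‖ = |r - a| * ‖s‖ := by
    rw [norm_smul, Complex.norm_real, Real.norm_eq_abs, abs_sub_comm]
  have h4 : X y - (r : ℂ) • y ∈ Sᗮ :=
    Sᗮ.sub_mem (hX.apply_mem_eigenspace_orthogonal hy) (Sᗮ.smul_mem _ hy)
  have h5 := norm_add_sq_eq_norm_sq_add_norm_sq_of_inner_eq_zero s y (hy s hs)
  have h6 := norm_add_sq_eq_norm_sq_add_norm_sq_of_inner_eq_zero (((a - r : ℝ) : ℂ) • s)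
    (X y - (r : ℂ) • y) (h4 _ (S.smul_mem _ hs))
  rw [h2]
  refine abs_le_of_sq_le_sq' ?_ (norm_nonneg _) |>.2
  have h7 : c * ‖s‖ ≤ |r - a| * ‖s‖ :=
    mul_le_mul_of_nonneg_right (min_le_left _ _) (norm_nonneg _)
  have h8 : (c * ‖s‖) * (c * ‖s‖) ≤ (|r - a| * ‖s‖) * (|r - a| * ‖s‖) :=
    mul_self_le_mul_self (by positivity) h7
  have h9 := mul_self_le_mul_self (by positivity) h1
  rw [h3] at h6
  have h10 : (c * ‖s + y‖) ^ 2 = c ^ 2 * (‖s + y‖ * ‖s + y‖) := by ring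
  rw [h10, h5, sq ‖_‖, h6]
  linarith

end HilbertSpace

/-! ### Bottom of the spectrum of a compact perturbation -/

section FredholmBottom

/-- The compact operator D⁻¹C restricts to the identity on V, so the unit ball of V is relatively
compact. -/
theorem finiteDimensional_of_compact {E : Type*} [NormedAddCommGroup E] [NormedSpace ℂ E]
    {D C : E →L[ℂ] E} (hD : IsUnit D)
    (hC : IsCompactOperator C)    (V : Submodule ℂ E) (hV : IsClosed (V : Set E)) (h : ∀ x ∈ V, D x = C x) :
    FiniteDimensional ℂ V := by
  obtain ⟨D, rfl⟩ := hD
  have h1 : ∀ x ∈ V, ((↑D⁻¹ : E →L[ℂ] E) * C) x = x := fun x hx => by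
    rw [mul_apply_eq_comp, ← h x hx, ← mul_apply_eq_comp, D.inv_mul]
    rfl
  have hC' : IsCompactOperator ((↑D⁻¹ : E →L[ℂ] E) * C) := hC.clm_comp _
  have h2 : IsCompactOperator (fun x : V => (x : E)) := by
    have he : (fun x : V => (x : E)) = ((↑D⁻¹ : E →L[ℂ] E) * C) ∘ V.subtypeL :=
      funext fun x => (h1 x x.2).symm
    rw [he]
    exact hC'.comp_clm V.subtypeL
  have h3 : IsCompactOperator (id : V → V) :=
    h2.codRestrict (f := fun x : V => (x : E)) (fun x => x.2) hV
  exact FiniteDimensional.of_isCompactOperator_id h3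

variable {E : Type*} [NormedAddCommGroup E] [InnerProductSpace ℂ E] [CompleteSpace E]

open scoped InnerProductSpace

theorem algebraMap_real_le_iff {X : E →L[ℂ] E} (hX : IsSelfAdjoint X) {r : ℝ} :
    algebraMap ℝ (E →L[ℂ] E) r ≤ X ↔ ∀ x, r * ‖x‖ ^ 2 ≤ (⟪X x, x⟫_ℂ).re := by
  have hr : ∀ x : E, (⟪(X - algebraMap ℝ (E →L[ℂ] E) r) x, x⟫_ℂ).re =
      (⟪X x, x⟫_ℂ).re - r * ‖x‖ ^ 2 := fun x => by
    have : (algebraMap ℝ (E →L[ℂ] E) r) x = (r : ℂ) • x := by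
      simp [Algebra.algebraMap_eq_smul_one]
    rw [sub_apply, this, inner_sub_left, inner_smul_left, inner_self_eq_norm_sq_to_K]
    simp [← Complex.ofReal_pow]
  rw [ContinuousLinearMap.le_def, ContinuousLinearMap.isPositive_def']
  constructor
  · intro h x
    have := h.2 x
    rw [ContinuousLinearMap.reApplyInnerSelf_apply] at this
    exact sub_nonneg.1 ((hr x).symm ▸ this)
  · intro h
    refine ⟨hX.sub ((IsSelfAdjoint.all r).algebraMap _), fun x => ?_⟩
    rw [ContinuousLinearMap.reApplyInnerSelf_apply]
    exact (sub_nonneg.2 (h x)).trans_eq (hr x).symm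

/-- The spectrum is a compact subset of (0, ∞), hence bounded away from 0. This is the source of the
spectral gap below. -/
theorem exists_pos_le_of_isUnit {X : E →L[ℂ] E} (hX : IsSelfAdjoint X) (hu : IsUnit X)
    (h : ∀ x, 0 ≤ (⟪X x, x⟫_ℂ).re) : ∃ ε > 0, ∀ x, ε * ‖x‖ ^ 2 ≤ (⟪X x, x⟫_ℂ).re := by
  rcases subsingleton_or_nontrivial E with hE | hE
  · exact ⟨1, one_pos, fun x => by simp [Subsingleton.elim x 0]⟩
  have h0 : 0 ≤ X := by
    have := (algebraMap_real_le_iff hX (r := 0)).2 (by simpa using h)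
    simpa using this
  have h1 : ∀ x ∈ spectrum ℝ X, 0 < x :=
    (StarOrderedRing.isStrictlyPositive_iff_spectrum_pos X).1 (hu.isStrictlyPositive h0)
  obtain ⟨r, hr, hrX⟩ := (CFC.exists_pos_algebraMap_le_iff hX).2 h1
  exact ⟨r, hr, (algebraMap_real_le_iff hX).1 hrX⟩

/-- The minimum of the spectrum of a self-adjoint operator bounds its quadratic form from below. -/
theorem exists_spectral_minimum [Nontrivial E] {X : E →L[ℂ] E} (hX : IsSelfAdjoint X) :
    ∃ a : ℝ, (∀ x, a * ‖x‖ ^ 2 ≤ (⟪X x, x⟫_ℂ).re) ∧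
      ¬ IsUnit (X - algebraMap ℝ (E →L[ℂ] E) a) := by
  have hc : IsCompact (spectrum ℝ X) := isCompact_iff_compactSpace.mpr inferInstance
  obtain ⟨a, ha, hmin⟩ := hc.exists_isMinOn
    (ContinuousFunctionalCalculus.spectrum_nonempty X hX) continuousOn_id
  refine ⟨a, (algebraMap_real_le_iff hX).1 (algebraMap_le_of_le_spectrum fun x hx => hmin hx), ?_⟩
  rw [spectrum.mem_iff] at ha
  rwa [← IsUnit.neg_iff, neg_sub]

/-- Fredholm alternative for D - C = D(1 - D⁻¹C): either 1 is an eigenvalue of the compact operator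
D⁻¹C, which injectivity excludes, or 1 - D⁻¹C is invertible. -/
theorem isUnit_sub_of_injective {D C : E →L[ℂ] E} (hD : IsUnit D) (hC : IsCompactOperator C)
    (h : ∀ x, D x = C x → x = 0) : IsUnit (D - C) := by
  obtain ⟨D, rfl⟩ := hD
  let C' : E →L[ℂ] E := (↑D⁻¹ : E →L[ℂ] E) * C
  have hC' : IsCompactOperator C' := hC.clm_comp _
  have hDC : (D : E →L[ℂ] E) - C = D * (1 - C') := by
    simp [C', mul_sub]
  rw [hDC]
  refine D.isUnit.mul ?_
  rcases hC'.hasEigenvalue_or_mem_resolventSet one_ne_zero with h1 | h1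
  · obtain ⟨x, hx, hx0⟩ := h1.exists_hasEigenvector
    rw [mem_eigenspace_clm, one_smul] at hx
    have h2 : ((D : E →L[ℂ] E) - C) x = 0 := by
      rw [hDC, mul_apply_eq_comp, sub_apply, hx]
      simp
    exact (hx0 (h x (sub_eq_zero.1 h2))).elim
  · simpa using spectrum.mem_resolventSet_iff.1 h1

/-- A compact perturbation of a nonnegative operator whose form takes negative values has an
isolated, negative spectral minimum of finite multiplicity. -/
theorem exists_isIsolatedBottom_sub {U K : E →L[ℂ] E} (hU : IsSelfAdjoint U)
    (hU0 : ∀ x, 0 ≤ (⟪U x, x⟫_ℂ).re) (hK : IsSelfAdjoint K) (hKc : IsCompactOperator K)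
    (hneg : ∃ x, (⟪(U - K) x, x⟫_ℂ).re < 0) : ∃ a δ, IsIsolatedBottom (U - K) a δ := by
  obtain ⟨x₀, hx₀⟩ := hneg
  have : Nontrivial E := ⟨x₀, 0, fun h => by simp [h] at hx₀⟩
  have hH := hU.sub hK
  obtain ⟨a, ha, hau⟩ := exists_spectral_minimum hH
  have ha0 : a < 0 := by
    by_contra h
    have := ha x₀
    nlinarith [sq_nonneg ‖x₀‖, mul_nonneg (not_lt.1 h) (sq_nonneg ‖x₀‖)]
  let Z : E →L[ℂ] E := algebraMap ℝ (E →L[ℂ] E) a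
  have hZ : ∀ x, Z x = (a : ℂ) • x := fun x => by simp [Z, Algebra.algebraMap_eq_smul_one]
  have hZs : IsSelfAdjoint Z := (IsSelfAdjoint.all a).algebraMap _
  have hZre : ∀ x, (⟪Z x, x⟫_ℂ).re = a * ‖x‖ ^ 2 := fun x => by
    rw [hZ, inner_smul_left, inner_self_eq_norm_sq_to_K]
    simp [← Complex.ofReal_pow]
  set H := U - K with hHdef
  set V := Module.End.eigenspace (H : E →ₗ[ℂ] E) (a : ℂ) with hVdef
  have hVc : IsClosed (V : Set E) := by
    have : (V : Set E) = {x | H x = (a : ℂ) • x} := Set.ext fun x => mem_eigenspace_clm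
    rw [this]
    exact isClosed_eq H.continuous (by fun_prop)
  -- Here U ≥ 0 and a < 0, so U - a ≥ -a > 0.
  have hD : IsUnit (U - Z) := by
    refine (hU.sub hZs).isUnit_of_le_norm (neg_pos.2 ha0) fun x => norm_mul_le_of_re_inner ?_
    rw [sub_apply, inner_sub_left, Complex.sub_re, hZre]
    linarith [hU0 x]
  have hVf : FiniteDimensional ℂ V := by
    refine finiteDimensional_of_compact hD hKc V hVc fun x hx => ?_
    have h1 : U x - K x = (a : ℂ) • x := mem_eigenspace_clm.1 hx
    rw [sub_apply, hZ, ← h1]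
    abel
  let P : E →L[ℂ] E := V.starProjection
  have hPs : IsSelfAdjoint P := isSelfAdjoint_starProjection V
  have hPc : IsCompactOperator P := by
    have : ProperSpace V := FiniteDimensional.proper ℂ V
    have hi : IsCompactOperator V.subtypeL :=
      isCompactOperator_of_locallyCompactSpace_rng V.subtypeL
    exact hi.comp_clm V.orthogonalProjectionOnto
  have hPre : ∀ x, (⟪P x, x⟫_ℂ).re = ‖P x‖ ^ 2 := fun x => by
    have h1 : P (P x) = P x := V.starProjection_eq_self_iff.2 (V.starProjection_apply_mem x)
    rw [← h1, hPs.clm_inner_left, h1, inner_self_eq_norm_sq_to_K]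
    simp [← Complex.ofReal_pow]
  -- This operator is H - a + P. If (H - a)x = -P x, pairing with P x, on which H - a vanishes,
  -- gives P x = 0; then x lies in the eigenspace and x = P x = 0. The Fredholm alternative upgrades
  -- injectivity to invertibility.
  have hX : IsUnit ((U - Z) - (K - P)) := by
    refine isUnit_sub_of_injective hD (hKc.sub hPc) fun x hx => ?_
    have h1 : (H x - (a : ℂ) • x) = - P x := by
      rw [sub_apply, sub_apply, hZ] at hx
      rw [hHdef, sub_apply]
      linear_combination (norm := module) hx
    have h2 : ⟪P x, H x - (a : ℂ) • x⟫_ℂ = 0 := by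
      have h3 : H (P x) = (a : ℂ) • P x := mem_eigenspace_clm.1 (V.starProjection_apply_mem x)
      rw [inner_sub_right, ← hH.clm_inner_left, h3, inner_smul_left, inner_smul_right]
      simp
    rw [h1, inner_neg_right, neg_eq_zero, inner_self_eq_zero] at h2
    rw [h2, neg_zero, sub_eq_zero] at h1
    rw [← h2]
    exact (V.starProjection_eq_self_iff.2 (mem_eigenspace_clm.2 h1)).symm
  have hXre : ∀ x, (⟪((U - Z) - (K - P)) x, x⟫_ℂ).re =
      (⟪H x, x⟫_ℂ).re - a * ‖x‖ ^ 2 + ‖P x‖ ^ 2 := fun x => by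
    rw [← hPre, ← hZre, hHdef]
    simp only [sub_apply, inner_sub_left, Complex.sub_re]
    ring
  -- The form of H - a + P is nonnegative, so invertibility gives a bound δ > 0. On the complement
  -- of the eigenspace P vanishes, and δ becomes the gap of H.
  obtain ⟨δ, hδ, hgap⟩ := exists_pos_le_of_isUnit ((hU.sub hZs).sub (hK.sub hPs)) hX fun x => by
    rw [hXre]
    nlinarith [ha x, sq_nonneg ‖P x‖]
  refine ⟨a, δ, hδ, ha, fun x hx => ?_, fun hbot => hau ?_, hVf⟩
  · have h1 := hgap x
    have h2 : P x = 0 := V.starProjection_apply_eq_zero_iff.2 hx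
    rw [hXre, h2, norm_zero] at h1
    linarith
  -- With a trivial eigenspace H - a itself would be invertible, against the choice of a in the
  -- spectrum.
  · have h2 : P = 0 := by
      ext x
      have h3 : P x ∈ V := V.starProjection_apply_mem x
      rw [← hVdef] at hbot
      rw [hbot] at h3
      exact h3
    rw [h2] at hX
    convert hX using 1
    simp only [hHdef, Z]
    abel

end FredholmBottom

/-! ### Hilbert tensor products and slices -/

section HilbertTensor

variable {E F G : Type*} [NormedAddCommGroup E] [InnerProductSpace ℂ E] [CompleteSpace E]
  [NormedAddCommGroup F] [InnerProductSpace ℂ F] [CompleteSpace F]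
  [NormedAddCommGroup G] [InnerProductSpace ℂ G] [CompleteSpace G]

open scoped InnerProductSpace
open ContinuousLinearMap (adjoint adjoint_inner_left adjoint_inner_right)

/-- A bilinear map exhibiting `G` as the Hilbert space tensor product of `E` and `F`. -/
structure IsHilbertTensor {E F G : Type*} [NormedAddCommGroup E] [InnerProductSpace ℂ E]
    [NormedAddCommGroup F] [InnerProductSpace ℂ F] [NormedAddCommGroup G] [InnerProductSpace ℂ G]
    (J : E →L[ℂ] F →L[ℂ] G) : Prop where
  inner_apply : ∀ x x' y y', ⟪J x y, J x' y'⟫_ℂ = ⟪x, x'⟫_ℂ * ⟪y, y'⟫_ℂ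
  total : ∀ f, (∀ x y, ⟪J x y, f⟫_ℂ = 0) → f = 0

namespace IsHilbertTensor

variable {J : E →L[ℂ] F →L[ℂ] G} {A : G →L[ℂ] G} {X : E →L[ℂ] E}

omit [CompleteSpace E] [CompleteSpace F] [CompleteSpace G] in
theorem flip (hJ : IsHilbertTensor J) : IsHilbertTensor J.flip where
  inner_apply x x' y y' := by
    simp only [ContinuousLinearMap.flip_apply, hJ.inner_apply]
    ring
  total f hf := hJ.total f fun x y => hf y x

omit [CompleteSpace E] [CompleteSpace F] [CompleteSpace G] in
theorem norm_apply (hJ : IsHilbertTensor J) (x : E) (y : F) : ‖J x y‖ = ‖x‖ * ‖y‖ := by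
  have h := hJ.inner_apply x x y y
  simp only [inner_self_eq_norm_sq_to_K] at h
  have h' : ‖J x y‖ ^ 2 = (‖x‖ * ‖y‖) ^ 2 := by
    rw [mul_pow]
    exact_mod_cast h
  exact (sq_eq_sq₀ (norm_nonneg _) (by positivity)).1 h'

omit [CompleteSpace E] [CompleteSpace F] [CompleteSpace G] in
theorem ext_inner (hJ : IsHilbertTensor J) {f g : G} (h : ∀ x y, ⟪J x y, f⟫_ℂ = ⟪J x y, g⟫_ℂ) :
    f = g :=
  sub_eq_zero.1 <| hJ.total _ fun x y => by rw [inner_sub_right, h, sub_self]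

omit [CompleteSpace E] [CompleteSpace F] in
-- If A and B agree on simple tensors, then (A - B)* (A - B) f is orthogonal to all of them, hence 0
-- by totality, and so (A - B) f = 0.
theorem ext_clm (hJ : IsHilbertTensor J) {A B : G →L[ℂ] G} (h : ∀ x y, A (J x y) = B (J x y)) :
    A = B := by
  ext f
  rw [← sub_eq_zero, ← inner_self_eq_zero (𝕜 := ℂ), ← sub_apply,
    ← adjoint_inner_right, hJ.total (adjoint (A - B) ((A - B) f)), inner_zero_right]
  intro x y
  rw [adjoint_inner_right, sub_apply, h, sub_self, inner_zero_left]

omit [CompleteSpace F] in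
theorem isSelfAdjoint (hJ : IsHilbertTensor J) (hX : IsSelfAdjoint X)
    (hA : ∀ x y, A (J x y) = J (X x) y) : IsSelfAdjoint A := by
  rw [ContinuousLinearMap.isSelfAdjoint_iff']
  refine hJ.ext_clm fun x y => hJ.ext_inner fun x' y' => ?_
  rw [adjoint_inner_right, hA, hA, hJ.inner_apply, hJ.inner_apply, hX.clm_inner_left]

omit [CompleteSpace E] [CompleteSpace F] in
theorem commute (hJ : IsHilbertTensor J) {B : G →L[ℂ] G} {Y : F →L[ℂ] F}
    (hA : ∀ x y, A (J x y) = J (X x) y) (hB : ∀ x y, B (J x y) = J x (Y y)) (f : G) :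
    A (B f) = B (A f) := by
  have : A * B = B * A := hJ.ext_clm fun x y => by
    simp only [mul_apply_eq_comp, hA, hB]
  exact congrArg (fun C : G →L[ℂ] G => C f) this

/-- The partial inner product of `f` with `y` in the second factor. -/
noncomputable def slice (J : E →L[ℂ] F →L[ℂ] G) (y : F) : G →L[ℂ] E :=
  adjoint (J.flip y)

omit [CompleteSpace F] in
theorem inner_slice (J : E →L[ℂ] F →L[ℂ] G) (x : E) (y : F) (f : G) :
    ⟪x, slice J y f⟫_ℂ = ⟪J x y, f⟫_ℂ := by
  rw [slice, adjoint_inner_right, ContinuousLinearMap.flip_apply]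

omit [CompleteSpace F] in
theorem slice_apply (hJ : IsHilbertTensor J) (hX : IsSelfAdjoint X)
    (hA : ∀ x y, A (J x y) = J (X x) y) (y : F) (f : G) :
    slice J y (A f) = X (slice J y f) := by
  refine ext_inner_left ℂ fun x => ?_
  rw [inner_slice, ← hX.clm_inner_left, inner_slice, ← hA,
    (hJ.isSelfAdjoint hX hA).clm_inner_left]

omit [CompleteSpace F] in
theorem exists_slice_ne_zero (hJ : IsHilbertTensor J) {f : G} (hf : f ≠ 0) :
    ∃ y, slice J y f ≠ 0 := by
  by_contra! h
  exact hf (hJ.total f fun x y => by rw [← inner_slice, h, inner_zero_right])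

omit [CompleteSpace F] in
/-- Eigenvectors of `X ⊗ 1` slice to eigenvectors of `X`. -/
theorem hasEigenvalue (hJ : IsHilbertTensor J) (hX : IsSelfAdjoint X)
    (hA : ∀ x y, A (J x y) = J (X x) y) {a : ℂ} {f : G} (hf : f ≠ 0) (hfa : A f = a • f) :
    Module.End.HasEigenvalue (X : E →ₗ[ℂ] E) a := by
  obtain ⟨y, hy⟩ := hJ.exists_slice_ne_zero hf
  refine Module.End.hasEigenvalue_of_hasEigenvector (x := slice J y f) ⟨?_, hy⟩
  rw [mem_eigenspace_clm, ← hJ.slice_apply hX hA, hfa, map_smul]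

/-- Parseval's identity for the slices along an orthonormal basis. -/
theorem hasSum_inner_slice (hJ : IsHilbertTensor J) {ι : Type*} (b : HilbertBasis ι ℂ F)
    (f g : G) : HasSum (fun i => ⟪slice J (b i) f, slice J (b i) g⟫_ℂ) ⟪f, g⟫_ℂ := by
  classical
  -- The maps x ↦ x ⊗ bᵢ are isometries with mutually orthogonal ranges. By totality they exhibit G
  -- as a Hilbert sum of copies of E, whose coordinates are the slices along bᵢ.
  let V : ι → E →ₗᵢ[ℂ] G := fun i =>
    { toLinearMap := (J.flip (b i) : E →L[ℂ] G).toLinearMap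
      norm_map' := fun x => by
        change ‖J x (b i)‖ = ‖x‖
        rw [hJ.norm_apply, b.orthonormal.1 i, mul_one] }
  have hV : ∀ i x, V i x = J x (b i) := fun i x => rfl
  have hort : OrthogonalFamily ℂ (fun _ : ι => E) V := fun i j hij x x' => by
    rw [hV, hV, hJ.inner_apply, b.orthonormal.2 hij, mul_zero]
  have hsum : IsHilbertSum ℂ (fun _ : ι => E) V := by
    refine IsHilbertSum.mk hort (top_le_iff.2 ?_)
    rw [Submodule.topologicalClosure_eq_top_iff, Submodule.eq_bot_iff]
    intro h hh
    have h1 : ∀ i x, ⟪J x (b i), h⟫_ℂ = 0 := fun i x =>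
      hh _ (Submodule.mem_iSup_of_mem i ⟨x, rfl⟩)
    refine hJ.total h fun x y => ?_
    have h2 : adjoint (J x) h = 0 := by
      refine b.repr.injective ?_
      ext i
      rw [b.repr_apply_apply, adjoint_inner_right, h1]
      simp
    rw [← adjoint_inner_right, h2, inner_zero_right]
  set e := hsum.linearIsometryEquiv
  have he : ∀ h i, e h i = slice J (b i) h := fun h i => by
    refine ext_inner_left ℂ fun x => ?_
    rw [inner_slice, ← hV, ← hsum.linearIsometryEquiv_symm_apply_single, ← e.inner_map_map,
      LinearIsometryEquiv.apply_symm_apply, lp.inner_single_left]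
  have := lp.hasSum_inner (𝕜 := ℂ) (e f) (e g)
  simpa only [he, e.inner_map_map] using this

/-- By Parseval, both sides are sums over the slices along an orthonormal basis of F, and slicing
intertwines A with X; the inequality holds term by term. -/
theorem le_re_inner (hJ : IsHilbertTensor J) (hX : IsSelfAdjoint X)
    (hA : ∀ x y, A (J x y) = J (X x) y) {c : ℝ} {f : G}
    (h : ∀ y, c * ‖slice J y f‖ ^ 2 ≤ (⟪X (slice J y f), slice J y f⟫_ℂ).re) :
    c * ‖f‖ ^ 2 ≤ (⟪A f, f⟫_ℂ).re := by
  obtain ⟨w, b, -⟩ := exists_hilbertBasis ℂ F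
  have h1 := Complex.hasSum_re (hJ.hasSum_inner_slice b (A f) f)
  have h2 := (Complex.hasSum_re (hJ.hasSum_inner_slice b f f)).mul_left c
  rw [re_inner_self_complex f] at h2
  refine hasSum_le (fun i => ?_) h2 h1
  rw [re_inner_self_complex, hJ.slice_apply hX hA]
  exact h _

omit [CompleteSpace F] in
theorem slice_mem_orthogonal (hA : ∀ x y, A (J x y) = J (X x) y) {a : ℂ} {f : G}
    (hf : f ∈ (Module.End.eigenspace (A : G →ₗ[ℂ] G) a)ᗮ) (y : F) :
    slice J y f ∈ (Module.End.eigenspace (X : E →ₗ[ℂ] E) a)ᗮ := by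
  intro x hx
  rw [inner_slice]
  refine hf _ ?_
  rw [mem_eigenspace_clm, hA, mem_eigenspace_clm.1 hx, map_smul]
  rfl

/-- Slices of a vector orthogonal to the eigenspace of X ⊗ 1 are orthogonal to that of X, so the gap
of X carries over with no finiteness needed for the eigenspace of X ⊗ 1. -/
theorem gap_le_re_inner (hJ : IsHilbertTensor J) (hX : IsSelfAdjoint X)
    (hA : ∀ x y, A (J x y) = J (X x) y) {a δ : ℝ} (hb : IsIsolatedBottom X a δ) {f : G}
    (hf : f ∈ (Module.End.eigenspace (A : G →ₗ[ℂ] G) (a : ℂ))ᗮ) :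
    (a + δ) * ‖f‖ ^ 2 ≤ (⟪A f, f⟫_ℂ).re :=
  hJ.le_re_inner hX hA fun y => hb.gap _ (slice_mem_orthogonal hA hf y)

end IsHilbertTensor

end HilbertTensor

/-! ### Discrete spectrum of X ⊗ 1 + 1 ⊗ Y -/

section HilbertTensorSum

open scoped InnerProductSpace

theorem isClosed_eigenspace_clm {E : Type*} [NormedAddCommGroup E] [NormedSpace ℂ E]
    (X : E →L[ℂ] E) (z : ℂ) :
    IsClosed (Module.End.eigenspace (X : E →ₗ[ℂ] E) z : Set E) := by
  have : (Module.End.eigenspace (X : E →ₗ[ℂ] E) z : Set E) = {x | X x = z • x} :=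
    Set.ext fun x => mem_eigenspace_clm
  rw [this]
  exact isClosed_eq X.continuous (by fun_prop)

theorem hasEigenvalue_mem_spectrum_clm {E : Type*} [NormedAddCommGroup E] [NormedSpace ℂ E]
    [CompleteSpace E] {X : E →L[ℂ] E} {z : ℂ}
    (h : Module.End.HasEigenvalue (X : E →ₗ[ℂ] E) z) : z ∈ spectrum ℂ X := by
  rw [ContinuousLinearMap.spectrum_eq]
  exact h.mem_spectrum

theorem exists_le_norm_of_notMem_spectrum {E : Type*} [NormedAddCommGroup E] [NormedSpace ℂ E]
    {X : E →L[ℂ] E} {z : ℂ} (hz : z ∉ spectrum ℂ X) :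
    ∃ c > 0, ∀ x, c * ‖x‖ ≤ ‖X x - z • x‖ := by
  rw [spectrum.notMem_iff] at hz
  obtain ⟨D, hD⟩ := hz
  set R : E →L[ℂ] E := (↑D⁻¹ : E →L[ℂ] E)
  refine ⟨(‖R‖ + 1)⁻¹, by positivity, fun x => ?_⟩
  have h1 : R (z • x - X x) = x := by
    have h2 : (D : E →L[ℂ] E) x = z • x - X x := by
      rw [hD]
      simp [Algebra.algebraMap_eq_smul_one]
    rw [← h2, ← mul_apply_eq_comp, D.inv_mul]
    rfl
  rw [inv_mul_le_iff₀ (by positivity), norm_sub_rev]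
  calc ‖x‖ = ‖R (z • x - X x)‖ := by rw [h1]
    _ ≤ ‖R‖ * ‖z • x - X x‖ := R.le_opNorm _
    _ ≤ (‖R‖ + 1) * ‖z • x - X x‖ := by gcongr; linarith

theorem re_inner_add_of_reducing {G : Type*} [NormedAddCommGroup G] [InnerProductSpace ℂ G]
    {C : G →L[ℂ] G} {V : Submodule ℂ G} (hV : ∀ x ∈ V, C x ∈ V) (hV' : ∀ x ∈ Vᗮ, C x ∈ Vᗮ)
    {x y : G} (hx : x ∈ V) (hy : y ∈ Vᗮ) :
    (⟪C (x + y), x + y⟫_ℂ).re = (⟪C x, x⟫_ℂ).re + (⟪C y, y⟫_ℂ).re := by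
  rw [map_add, inner_add_left, inner_add_right, inner_add_right, hy _ (hV x hx),
    V.inner_left_of_mem_orthogonal hx (hV' y hy)]
  simp

namespace IsHilbertTensor

variable {E F G : Type*} [NormedAddCommGroup E] [InnerProductSpace ℂ E] [CompleteSpace E]
  [NormedAddCommGroup F] [InnerProductSpace ℂ F] [CompleteSpace F]
  [NormedAddCommGroup G] [InnerProductSpace ℂ G] [CompleteSpace G]
  {J : E →L[ℂ] F →L[ℂ] G} {A B : G →L[ℂ] G} {X : E →L[ℂ] E} {Y : F →L[ℂ] F}

omit [CompleteSpace E] [CompleteSpace F] [CompleteSpace G] in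
theorem apply_ne_zero (hJ : IsHilbertTensor J) {x : E} {y : F} (hx : x ≠ 0) (hy : y ≠ 0) :
    J x y ≠ 0 := by
  rw [← norm_ne_zero_iff, hJ.norm_apply]
  exact mul_ne_zero (norm_ne_zero_iff.2 hx) (norm_ne_zero_iff.2 hy)

omit [CompleteSpace F] [CompleteSpace G] in
-- For an eigenvector y of Y at b, the map x ↦ x ⊗ y is a nonzero multiple of an isometry and
-- intertwines X + b with A + B. Lower bounds for A + B - (w + b) therefore pass to X - w, which
-- gives σ(X) + b ⊆ σ(A + B) since X is self-adjoint; eigenspaces embed likewise.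
theorem mem_discreteSpectrum_of_add (hJ : IsHilbertTensor J) (hX : IsSelfAdjoint X)
    (hA : ∀ x y, A (J x y) = J (X x) y) (hB : ∀ x y, B (J x y) = J x (Y y)) {a b : ℂ}
    (ha : Module.End.HasEigenvalue (X : E →ₗ[ℂ] E) a)
    (hb : Module.End.HasEigenvalue (Y : F →ₗ[ℂ] F) b)
    (hz : a + b ∈ discreteSpectrum (A + B)) : a ∈ discreteSpectrum X := by
  obtain ⟨-, ⟨ε, hε, hiso⟩, -, hfin⟩ := hz
  obtain ⟨y, hy, hy0⟩ := hb.exists_hasEigenvector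
  rw [mem_eigenspace_clm] at hy
  have hAB : ∀ x, (A + B) (J x y) = J (X x + b • x) y := fun x => by
    rw [add_apply, hA, hB, hy]
    simp
  refine ⟨hasEigenvalue_mem_spectrum_clm ha, ⟨ε, hε, fun w hw hwa => ?_⟩, ha, ?_⟩
  · refine add_right_cancel (b := b) (hiso _ ?_ (by simpa using hwa))
    by_contra hn
    obtain ⟨c, hc, hcb⟩ := exists_le_norm_of_notMem_spectrum hn
    obtain ⟨r, rfl⟩ : ∃ r : ℝ, w = r := ⟨w.re, hX.mem_spectrum_eq_re hw⟩
    refine hX.notMem_spectrum_of_le_norm hc (fun x => ?_) hw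
    have h1 := hcb (J x y)
    have h2 : (A + B) (J x y) - ((r : ℂ) + b) • J x y = J (X x - (r : ℂ) • x) y := by
      rw [hAB]
      simp only [map_add, map_sub, map_smul, add_apply, sub_apply, smul_apply]
      module
    rw [h2, hJ.norm_apply, hJ.norm_apply, ← mul_assoc] at h1
    exact le_of_mul_le_mul_right h1 (norm_pos_iff.2 hy0)
  · let L : Module.End.eigenspace (X : E →ₗ[ℂ] E) a →ₗ[ℂ]
        Module.End.eigenspace ((A + B : G →L[ℂ] G) : G →ₗ[ℂ] G) (a + b) :=
      LinearMap.codRestrict _ ((J.flip y : E →ₗ[ℂ] G) ∘ₗ Submodule.subtype _) fun x => by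
        rw [mem_eigenspace_clm]
        change (A + B) (J x y) = (a + b) • J x y
        rw [hAB, mem_eigenspace_clm.1 x.2]
        simp only [map_add, map_smul, add_apply, smul_apply]
        module
    refine FiniteDimensional.of_injective L ((injective_iff_map_eq_zero L).2 fun x hx => ?_)
    by_contra hx0
    exact hJ.apply_ne_zero (x := (x : E)) (by simpa using hx0) hy0 (congrArg Subtype.val hx)

/-- Points of the discrete spectrum of `X ⊗ 1 + 1 ⊗ Y` are sums of points of the discrete
spectra. -/
theorem exists_add_of_mem_discreteSpectrum (hJ : IsHilbertTensor J) (hX : IsSelfAdjoint X)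
    (hY : IsSelfAdjoint Y) (hA : ∀ x y, A (J x y) = J (X x) y)
    (hB : ∀ x y, B (J x y) = J x (Y y)) {z : ℂ} (hz : z ∈ discreteSpectrum (A + B)) :
    ∃ a ∈ discreteSpectrum X, ∃ b ∈ discreteSpectrum Y, a + b = z := by
  obtain ⟨-, -, hev, hfin⟩ := id hz
  set W := Module.End.eigenspace ((A + B : G →L[ℂ] G) : G →ₗ[ℂ] G) z
  have : Nontrivial W := (Submodule.nontrivial_iff_ne_bot).2 hev
  -- A commutes with A + B, so it acts on the nonzero finite-dimensional space W and has an
  -- eigenvector f there. Then f is an eigenvector of B at z - a.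
  have hAW : ∀ f ∈ W, (A : G →ₗ[ℂ] G) f ∈ W := fun f hf => by
    have h1 := mem_eigenspace_clm.1 hf
    refine mem_eigenspace_clm.2 ?_
    change (A + B) (A f) = z • A f
    rw [← map_smul, ← h1, add_apply, add_apply, map_add, hJ.commute hA hB]
  obtain ⟨a, ha⟩ := Module.End.exists_eigenvalue ((A : G →ₗ[ℂ] G).restrict hAW)
  obtain ⟨f, hf, hf0⟩ := ha.exists_hasEigenvector
  have hfa : A f = a • (f : G) := congrArg Subtype.val (Module.End.mem_eigenspace_iff.1 hf)
  have hfz : A f + B f = z • (f : G) := mem_eigenspace_clm.1 f.2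
  have hfb : B f = (z - a) • (f : G) := by
    rw [sub_smul, ← hfz, hfa]
    abel
  have hf0' : (f : G) ≠ 0 := by simpa using hf0
  have ha' := hJ.hasEigenvalue hX hA hf0' hfa
  have hB' : ∀ y x, B (J.flip y x) = J.flip (Y y) x := fun y x => hB x y
  have hA' : ∀ y x, A (J.flip y x) = J.flip y (X x) := fun y x => hA x y
  have hb' := hJ.flip.hasEigenvalue hY hB' hf0' hfb
  refine ⟨a, hJ.mem_discreteSpectrum_of_add hX hA hB ha' hb' ?_, z - a,
    hJ.flip.mem_discreteSpectrum_of_add hY hB' hA' hb' ha' ?_, by ring⟩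
  · rwa [add_sub_cancel]
  · rwa [sub_add_cancel, add_comm B A]

/-- Slicing a joint eigenvector along an orthonormal basis of V gives finitely many vectors of W.
They determine it: its slices along F lie in V, and their coordinates are read off from those
vectors. -/
theorem finiteDimensional_inf_eigenspace (hJ : IsHilbertTensor J) (hX : IsSelfAdjoint X)
    (hY : IsSelfAdjoint Y) (hA : ∀ x y, A (J x y) = J (X x) y)
    (hB : ∀ x y, B (J x y) = J x (Y y)) {a b : ℂ}
    [FiniteDimensional ℂ (Module.End.eigenspace (X : E →ₗ[ℂ] E) a)]
    [FiniteDimensional ℂ (Module.End.eigenspace (Y : F →ₗ[ℂ] F) b)] :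
    FiniteDimensional ℂ (Module.End.eigenspace (A : G →ₗ[ℂ] G) a ⊓
      Module.End.eigenspace (B : G →ₗ[ℂ] G) b : Submodule ℂ G) := by
  set S := Module.End.eigenspace (A : G →ₗ[ℂ] G) a ⊓ Module.End.eigenspace (B : G →ₗ[ℂ] G) b
  set V := Module.End.eigenspace (X : E →ₗ[ℂ] E) a
  set W := Module.End.eigenspace (Y : F →ₗ[ℂ] F) b
  let e := stdOrthonormalBasis ℂ V
  have hB' : ∀ y x, B (J.flip y x) = J.flip (Y y) x := fun y x => hB x y
  let L : S →ₗ[ℂ] (Fin (Module.finrank ℂ V) → W) := LinearMap.pi fun i =>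
    LinearMap.codRestrict W ((slice J.flip (e i : E) : G →ₗ[ℂ] F) ∘ₗ S.subtype) fun f => by
      refine mem_eigenspace_clm.2 ?_
      change Y (slice J.flip (e i : E) (f : G)) = b • slice J.flip (e i : E) (f : G)
      rw [← hJ.flip.slice_apply hY hB', mem_eigenspace_clm.1 f.2.2, map_smul]
  refine FiniteDimensional.of_injective L ((injective_iff_map_eq_zero L).2 fun f hf => ?_)
  by_contra hf0
  obtain ⟨y, hy⟩ := hJ.exists_slice_ne_zero (f := (f : G)) (by simpa using hf0)
  have hyV : slice J y (f : G) ∈ V := by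
    rw [mem_eigenspace_clm, ← hJ.slice_apply hX hA, mem_eigenspace_clm.1 f.2.1, map_smul]
  have h0 : (⟨_, hyV⟩ : V) = 0 := by
    refine e.repr.injective ?_
    ext i
    have h1 : slice J.flip (e i : E) (f : G) = 0 :=
      congrArg Subtype.val (congrFun hf i)
    rw [e.repr_apply_apply, Submodule.coe_inner, inner_slice]
    change ⟪J.flip y (e i : E), (f : G)⟫_ℂ = _
    rw [ContinuousLinearMap.flip_apply]
    have h2 := inner_slice J.flip y (e i : E) (f : G)
    rw [h1, inner_zero_right, ContinuousLinearMap.flip_apply] at h2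
    rw [← h2]
    simp
  exact hy (congrArg Subtype.val h0)

/-- The bottom eigenspace of A + B is S = V ⊓ W. Split f ⊥ S along V and Vᗮ, which reduce both A and
B: the part in Vᗮ gains δ from A, and the part in V is orthogonal to W and gains δ' from B. -/
theorem isIsolatedBottom_add (hJ : IsHilbertTensor J) (hX : IsSelfAdjoint X)
    (hY : IsSelfAdjoint Y) (hA : ∀ x y, A (J x y) = J (X x) y)
    (hB : ∀ x y, B (J x y) = J x (Y y)) {a b δ δ' : ℝ} (ha : IsIsolatedBottom X a δ)
    (hb : IsIsolatedBottom Y b δ') :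
    IsIsolatedBottom (A + B) (a + b) (min δ δ') := by
  have hB' : ∀ y x, B (J.flip y x) = J.flip (Y y) x := fun y x => hB x y
  have hAs := hJ.isSelfAdjoint hX hA
  have hBs := hJ.flip.isSelfAdjoint hY hB'
  have hAle : ∀ f, a * ‖f‖ ^ 2 ≤ (⟪A f, f⟫_ℂ).re := fun f =>
    hJ.le_re_inner hX hA fun y => ha.le _
  have hBle : ∀ f, b * ‖f‖ ^ 2 ≤ (⟪B f, f⟫_ℂ).re := fun f =>
    hJ.flip.le_re_inner hY hB' fun y => hb.le _
  have hadd : ∀ f, (⟪(A + B) f, f⟫_ℂ).re = (⟪A f, f⟫_ℂ).re + (⟪B f, f⟫_ℂ).re := fun f => by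
    rw [add_apply, inner_add_left, Complex.add_re]
  have := ha.finite
  have := hb.finite
  have hSf := hJ.finiteDimensional_inf_eigenspace hX hY hA hB (a := a) (b := b)
  set V := Module.End.eigenspace (A : G →ₗ[ℂ] G) (a : ℂ) with hV
  set W := Module.End.eigenspace (B : G →ₗ[ℂ] G) (b : ℂ) with hW
  set S := V ⊓ W with hS
  set Z := Module.End.eigenspace ((A + B : G →L[ℂ] G) : G →ₗ[ℂ] G) ((a + b : ℝ) : ℂ) with hZ
  have hSZ : S ≤ Z := fun f hf => by
    rw [hZ, mem_eigenspace_clm, add_apply, mem_eigenspace_clm.1 hf.1, mem_eigenspace_clm.1 hf.2]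
    push_cast
    module
  have hVc : CompleteSpace V := (isClosed_eigenspace_clm A a).completeSpace_coe
  have hBV : ∀ f ∈ V, B f ∈ V := fun f hf => by
    rw [hV, mem_eigenspace_clm, hJ.commute hA hB, mem_eigenspace_clm.1 hf, map_smul]
  have hBV' : ∀ f ∈ Vᗮ, B f ∈ Vᗮ := fun f hf g hg => by
    rw [← hBs.clm_inner_left]
    exact hf _ (hBV g hg)
  have hAV : ∀ f ∈ V, A f ∈ V := fun f hf => by
    rw [mem_eigenspace_clm.1 hf]
    exact V.smul_mem _ hf
  have hAV' : ∀ f ∈ Vᗮ, A f ∈ Vᗮ := fun f hf => hAs.apply_mem_eigenspace_orthogonal hf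
  have hgap : ∀ f ∈ Sᗮ, (a + b + min δ δ') * ‖f‖ ^ 2 ≤ (⟪(A + B) f, f⟫_ℂ).re := by
    intro f hf
    obtain ⟨f₁, hf₁, f₂, hf₂, rfl⟩ := V.exists_add_mem_mem_orthogonal f
    -- Since B preserves V and Vᗮ, the V-component g₁ of a vector of W is again in W, hence in S,
    -- and f is orthogonal to it.
    have hf₁W : f₁ ∈ Wᗮ := by
      intro g hg
      obtain ⟨g₁, hg₁, g₂, hg₂, rfl⟩ := V.exists_add_mem_mem_orthogonal g
      have h1 : B g₁ - (b : ℂ) • g₁ = -(B g₂ - (b : ℂ) • g₂) := by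
        have := mem_eigenspace_clm.1 hg
        rw [map_add] at this
        linear_combination (norm := module) this
      have h2 : B g₁ - (b : ℂ) • g₁ = 0 := by
        refine (Submodule.disjoint_def.1 V.orthogonal_disjoint) _
          (V.sub_mem (hBV _ hg₁) (V.smul_mem _ hg₁)) ?_
        rw [h1]
        exact Vᗮ.neg_mem (Vᗮ.sub_mem (hBV' _ hg₂) (Vᗮ.smul_mem _ hg₂))
      have h3 : g₁ ∈ S := ⟨hg₁, mem_eigenspace_clm.2 (sub_eq_zero.1 h2)⟩
      have h4 := hf _ h3
      rw [inner_add_right, hf₂ _ hg₁, add_zero] at h4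
      rw [inner_add_left, h4, V.inner_left_of_mem_orthogonal hf₁ hg₂, add_zero]
    rw [hadd, re_inner_add_of_reducing hAV hAV' hf₁ hf₂,
      re_inner_add_of_reducing hBV hBV' hf₁ hf₂, sq ‖f₁ + f₂‖,
      norm_add_sq_eq_norm_sq_add_norm_sq_of_inner_eq_zero f₁ f₂ (hf₂ _ hf₁)]
    have h1 := hAle f₁
    have h2 := hJ.gap_le_re_inner hX hA ha hf₂
    have h3 := hJ.flip.gap_le_re_inner hY hB' hb hf₁W
    have h4 := hBle f₂
    have h5 := mul_le_mul_of_nonneg_right (min_le_left δ δ') (sq_nonneg ‖f₂‖)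
    have h6 := mul_le_mul_of_nonneg_right (min_le_right δ δ') (sq_nonneg ‖f₁‖)
    linarith
  have hpos : 0 < min δ δ' := lt_min ha.pos hb.pos
  -- The component of f orthogonal to S is again an eigenvector at a + b, which the gap forces to
  -- vanish.
  have hZS : Z ≤ S := fun f hf => by
    obtain ⟨s, hs, r, hr, rfl⟩ := S.exists_add_mem_mem_orthogonal f
    have h1 : r ∈ Z := by
      have := Z.sub_mem hf (hSZ hs)
      rwa [add_sub_cancel_left] at this
    have h2 := hgap r hr
    rw [mem_eigenspace_clm.1 h1, inner_smul_left, Complex.conj_ofReal, Complex.re_ofReal_mul,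
      re_inner_self_complex] at h2
    have h3 : r = 0 := by
      by_contra h
      have := norm_pos_iff.2 h
      nlinarith [mul_pos hpos (pow_pos this 2)]
    rwa [h3, add_zero]
  refine ⟨hpos, fun f => ?_, fun f hf => hgap f (Submodule.orthogonal_le hSZ hf), ?_,
    Submodule.finiteDimensional_of_le hZS⟩
  · rw [hadd]
    linarith [hAle f, hBle f]
  · obtain ⟨x, hx, hx0⟩ := Submodule.exists_mem_ne_zero_of_ne_bot ha.ne_bot
    obtain ⟨y, hy, hy0⟩ := Submodule.exists_mem_ne_zero_of_ne_bot hb.ne_bot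
    refine (Submodule.ne_bot_iff _).2 ⟨J x y, hSZ (Submodule.mem_inf.2 ⟨?_, ?_⟩),
      hJ.apply_ne_zero hx0 hy0⟩
    · rw [hV, mem_eigenspace_clm, hA, mem_eigenspace_clm.1 hx, map_smul]
      rfl
    · rw [hW, mem_eigenspace_clm, hB, mem_eigenspace_clm.1 hy, map_smul]

end IsHilbertTensor

end HilbertTensorSum

/-! ### Separated kernels and compactness of integral operators -/

section Compactness

theorem isCompactOperator_of_forall_mem {E F : Type*} [NormedAddCommGroup E] [NormedSpace ℂ E]
    [NormedAddCommGroup F] [NormedSpace ℂ F] {C : E →L[ℂ] F} (V : Submodule ℂ F)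
    [FiniteDimensional ℂ V] (h : ∀ x, C x ∈ V) : IsCompactOperator C := by
  have : ProperSpace V := FiniteDimensional.proper ℂ V
  have hi : IsCompactOperator V.subtypeL := isCompactOperator_of_locallyCompactSpace_rng V.subtypeL
  exact hi.comp_clm (C.codRestrict V h)

/-- Distinct orthonormal vectors are √2 apart, so their images stay at least c apart and have no
Cauchy subsequence. -/
theorem not_isCompactOperator_of_orthonormal {E F : Type*} [NormedAddCommGroup E]
    [InnerProductSpace ℂ E] [NormedAddCommGroup F] [NormedSpace ℂ F] {C : E →L[ℂ] F} {φ : ℕ → E}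
    (hφ : Orthonormal ℂ φ) {c : ℝ} (hc : 0 < c)
    (h : ∀ m n, c * ‖φ m - φ n‖ ≤ ‖C (φ m - φ n)‖) : ¬ IsCompactOperator C := by
  intro hC
  obtain ⟨K, hK, hKs⟩ := hC.image_closedBall_subset_compact 1
  obtain ⟨y, -, ψ, hψ, hlim⟩ := hK.tendsto_subseq (x := fun n => C (φ n))
    fun n => hKs ⟨φ n, by simp [hφ.1 n], rfl⟩
  obtain ⟨N, hN⟩ := Metric.cauchySeq_iff'.1 hlim.cauchySeq c hc
  have h1 := hN (N + 1) (by lia)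
  have hne : ψ (N + 1) ≠ ψ N := (hψ (Nat.lt_succ_self N)).ne'
  rw [Function.comp_apply, Function.comp_apply, dist_eq_norm, ← map_sub] at h1
  have h2 := h (ψ (N + 1)) (ψ N)
  have h3 : ‖φ (ψ (N + 1)) - φ (ψ N)‖ ^ 2 = 2 := by
    rw [norm_sub_sq (𝕜 := ℂ), hφ.1, hφ.1, hφ.2 hne]
    norm_num
  have h4 : 1 ≤ ‖φ (ψ (N + 1)) - φ (ψ N)‖ := by
    nlinarith [norm_nonneg (φ (ψ (N + 1)) - φ (ψ N))]
  nlinarith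

/-- The function `(x, s) ↦ g x * h s`. -/
noncomputable def prodFun (g h : C(unitInterval, ℂ)) : C(unitInterval × unitInterval, ℂ) where
  toFun p := g p.1 * h p.2
  continuous_toFun := by fun_prop

/-- Stone–Weierstrass: the span is a unital star subalgebra, and the coordinate functions in it
separate points. -/
theorem span_prodFun_topologicalClosure :
    (Submodule.span ℂ (Set.range fun p : C(unitInterval, ℂ) × C(unitInterval, ℂ) =>
      prodFun p.1 p.2)).topologicalClosure = ⊤ := by
  set S := Set.range fun p : C(unitInterval, ℂ) × C(unitInterval, ℂ) => prodFun p.1 p.2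
  have hmem : ∀ g h, prodFun g h ∈ Submodule.span ℂ S := fun g h =>
    Submodule.subset_span ⟨(g, h), rfl⟩
  let A : StarSubalgebra ℂ C(unitInterval × unitInterval, ℂ) :=
    { (Submodule.span ℂ S).toSubalgebra
        (by
          convert hmem 1 1 using 1
          ext p
          simp [prodFun])
        (fun x y hx hy => by
          induction hx, hy using Submodule.span_induction₂ with
          | mem_mem x y hx hy =>
            obtain ⟨⟨g, h⟩, rfl⟩ := hx
            obtain ⟨⟨g', h'⟩, rfl⟩ := hy
            convert hmem (g * g') (h * h') using 1
            ext p
            simp only [prodFun, ContinuousMap.mul_apply, ContinuousMap.coe_mk]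
            ring
          | zero_left => simp
          | zero_right => simp
          | add_left x y z _ _ _ h1 h2 => rw [add_mul]; exact add_mem h1 h2
          | add_right x y z _ _ _ h1 h2 => rw [mul_add]; exact add_mem h1 h2
          | smul_left r x y _ _ h1 => rw [smul_mul_assoc]; exact Submodule.smul_mem _ _ h1
          | smul_right r x y _ _ h1 => rw [mul_smul_comm]; exact Submodule.smul_mem _ _ h1) with
      star_mem' := fun {x} hx => by
        change star x ∈ Submodule.span ℂ S
        change x ∈ Submodule.span ℂ S at hx
        induction hx using Submodule.span_induction with
        | mem x hx =>
          obtain ⟨⟨g, h⟩, rfl⟩ := hx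
          convert hmem (star g) (star h) using 1
          ext p
          simp [prodFun]
        | zero => simp
        | add x y _ _ h1 h2 => rw [star_add]; exact add_mem h1 h2
        | smul r x _ h1 => rw [star_smul]; exact Submodule.smul_mem _ _ h1 }
  let ι : C(unitInterval, ℂ) := ⟨fun x => ((x : ℝ) : ℂ), by fun_prop⟩
  have hι : ∀ x y, ι x = ι y → x = y := fun x y h => Subtype.ext (Complex.ofReal_injective h)
  have hA : A.SeparatesPoints := by
    intro x y hxy
    by_cases h1 : x.1 = y.1
    · refine ⟨_, ⟨prodFun 1 ι, hmem _ _, rfl⟩, fun h => hxy (Prod.ext h1 (hι _ _ ?_))⟩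
      simpa [prodFun] using h
    · refine ⟨_, ⟨prodFun ι 1, hmem _ _, rfl⟩, fun h => h1 (hι _ _ ?_)⟩
      simpa [prodFun] using h
  have hd := ContinuousMap.starSubalgebra_topologicalClosure_eq_top_of_separatesPoints A hA
  rw [Submodule.eq_top_iff']
  intro k
  have hk : k ∈ A.topologicalClosure := by rw [hd]; trivial
  exact hk

theorem eq_top_of_prodFun_mem (V : Submodule ℂ C(unitInterval × unitInterval, ℂ))
    (hV : IsClosed (V : Set C(unitInterval × unitInterval, ℂ))) (h : ∀ g h, prodFun g h ∈ V) :
    V = ⊤ := by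
  rw [← top_le_iff, ← span_prodFun_topologicalClosure]
  refine Submodule.topologicalClosure_minimal _ (Submodule.span_le.2 ?_) hV
  rintro _ ⟨p, rfl⟩
  exact h _ _

theorem kernelOp_coeFn (k : C(unitInterval × unitInterval, ℂ)) (φ : L2Interval) :
    kernelOp k φ =ᵐ[volume] kernelFun k φ :=
  (kernelFun_memLp k (Lp.memLp φ)).coeFn_toLp

theorem norm_kernelOp_le (k : C(unitInterval × unitInterval, ℂ)) : ‖kernelOp k‖ ≤ ‖k‖ :=
  LinearMap.mkContinuous_norm_le _ (norm_nonneg k) _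

/-- The dependence of the integral operator on its kernel. -/
noncomputable def kernelOpL :
    C(unitInterval × unitInterval, ℂ) →L[ℂ] (L2Interval →L[ℂ] L2Interval) :=
  LinearMap.mkContinuous
    { toFun := kernelOp
      map_add' := fun k k' => by
        ext1 φ
        refine Lp.ext ?_
        rw [add_apply]
        filter_upwards [kernelOp_coeFn (k + k') φ, kernelOp_coeFn k φ, kernelOp_coeFn k' φ,
          Lp.coeFn_add (kernelOp k φ) (kernelOp k' φ)] with x h1 h2 h3 h4
        rw [h1, h4, Pi.add_apply, h2, h3]
        simp only [kernelFun, ContinuousMap.add_apply, add_mul]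
        exact integral_add (kernel_integrable k (Lp.memLp φ) x)
          (kernel_integrable k' (Lp.memLp φ) x)
      map_smul' := fun c k => by
        ext1 φ
        refine Lp.ext ?_
        rw [RingHom.id_apply, smul_apply]
        filter_upwards [kernelOp_coeFn (c • k) φ, kernelOp_coeFn k φ,
          Lp.coeFn_smul c (kernelOp k φ)] with x h1 h2 h3
        rw [h1, h3, Pi.smul_apply, h2]
        simp only [kernelFun, ContinuousMap.smul_apply, smul_eq_mul, mul_assoc]
        exact integral_const_mul _ _ }
    1 fun k => by rw [one_mul]; exact norm_kernelOp_le k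

/-- The operator depends continuously on its kernel, compact operators form a closed subspace, and a
separated kernel gives rank at most one. -/
theorem isCompactOperator_kernelOp (k : C(unitInterval × unitInterval, ℂ)) :
    IsCompactOperator (kernelOp k) := by
  let V : Submodule ℂ C(unitInterval × unitInterval, ℂ) :=
    (compactOperator (RingHom.id ℂ) L2Interval L2Interval).comap
      (kernelOpL : C(unitInterval × unitInterval, ℂ) →ₗ[ℂ] (L2Interval →L[ℂ] L2Interval))
  have hV : IsClosed (V : Set C(unitInterval × unitInterval, ℂ)) :=
    (isClosed_setOfPred_isCompactOperator (𝕜₁ := ℂ) (σ₁₂ := RingHom.id ℂ) (M₁ := L2Interval)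
      (M₂ := L2Interval)).preimage kernelOpL.continuous
  have hmem : k ∈ V := by
    rw [eq_top_of_prodFun_mem V hV fun g h => ?_]
    · trivial
    change IsCompactOperator (kernelOp (prodFun g h))
    let gL : L2Interval := ContinuousMap.toLp 2 volume ℂ g
    refine isCompactOperator_of_forall_mem (Submodule.span ℂ {gL}) fun φ => ?_
    refine Submodule.mem_span_singleton.2 ⟨∫ s, h s * φ s, Lp.ext ?_⟩
    filter_upwards [kernelOp_coeFn (prodFun g h) φ, Lp.coeFn_smul (∫ s, h s * φ s) gL,
      ContinuousMap.coeFn_toLp (p := 2) (𝕜 := ℂ) volume g] with x h1 h2 h3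
    rw [h1, h2, Pi.smul_apply, h3, smul_eq_mul, mul_comm, ← integral_const_mul]
    simp only [kernelFun, prodFun, ContinuousMap.coe_mk, mul_assoc]
  exact hmem

end Compactness

/-! ### Multiplication operators -/

section MultiplicationOperators

open scoped InnerProductSpace

variable {X : Type*} [TopologicalSpace X] [MeasurableSpace X] [CompactSpace X] [BorelSpace X]
  {μ : Measure X}

theorem mulOp_coeFn (w : C(X, ℝ)) (f : Lp ℂ 2 μ) :
    mulOp μ w f =ᵐ[μ] fun x => (w x : ℂ) * f x :=
  (mulFun_memLp w f).coeFn_toLp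

theorem mulOp_isSelfAdjoint (w : C(X, ℝ)) : IsSelfAdjoint (mulOp μ w) := by
  rw [ContinuousLinearMap.isSelfAdjoint_iff_isSymmetric]
  intro f g
  change ⟪mulOp μ w f, g⟫_ℂ = ⟪f, mulOp μ w g⟫_ℂ
  rw [L2.inner_def, L2.inner_def]
  refine integral_congr_ae ?_
  filter_upwards [mulOp_coeFn w f, mulOp_coeFn w g] with x h1 h2
  rw [h1, h2]
  simp only [RCLike.inner_apply, map_mul, Complex.conj_ofReal]
  ring

theorem mulOp_re_inner_nonneg {w : C(X, ℝ)} (hw : ∀ x, 0 ≤ w x) (f : Lp ℂ 2 μ) :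
    0 ≤ (⟪mulOp μ w f, f⟫_ℂ).re := by
  have h1 : ⟪mulOp μ w f, f⟫_ℂ = ∫ x, ((w x * ‖f x‖ ^ 2 : ℝ) : ℂ) ∂μ := by
    rw [L2.inner_def]
    refine integral_congr_ae ?_
    filter_upwards [mulOp_coeFn w f] with x h1
    rw [h1, RCLike.inner_apply, map_mul, Complex.conj_ofReal, mul_left_comm, Complex.mul_conj']
    push_cast
    rfl
  rw [h1, integral_complex_ofReal, Complex.ofReal_re]
  exact integral_nonneg fun x => mul_nonneg (hw x) (sq_nonneg _)

theorem mulOp_re_inner_le (w : C(X, ℝ)) (f : Lp ℂ 2 μ) :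
    (⟪mulOp μ w f, f⟫_ℂ).re ≤ ‖w‖ * ‖f‖ ^ 2 := by
  have h1 : (⟪mulOp μ w f, f⟫_ℂ).re ≤ ‖mulOp μ w f‖ * ‖f‖ := re_inner_le_norm (𝕜 := ℂ) _ _
  have h2 : ‖mulOp μ w f‖ ≤ ‖w‖ * ‖f‖ :=
    (mulOp μ w).le_of_opNorm_le (LinearMap.mkContinuous_norm_le _ (norm_nonneg w) _) f
  nlinarith [norm_nonneg f]

/-- On functions supported where `w` is within `ε` of `r`, multiplication by `w` is within `ε` of
multiplication by `r`. -/
theorem norm_mulOp_sub_le {w : C(X, ℝ)} {r ε : ℝ} {f : Lp ℂ 2 μ}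
    (hf : ∀ᵐ x ∂μ, ε < |w x - r| → f x = 0) :
    ‖mulOp μ w f - (r : ℂ) • f‖ ≤ ε * ‖f‖ := by
  refine Lp.norm_le_mul_norm_of_ae_le_mul ?_
  filter_upwards [hf, mulOp_coeFn w f, Lp.coeFn_sub (mulOp μ w f) ((r : ℂ) • f),
    Lp.coeFn_smul (r : ℂ) f] with x h1 h2 h3 h4
  rw [h3, Pi.sub_apply, h2, h4, Pi.smul_apply, smul_eq_mul, ← sub_mul, ← Complex.ofReal_sub,
    norm_mul, Complex.norm_real, Real.norm_eq_abs]
  by_cases h : ε < |w x - r|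
  · rw [h1 h]
    simp
  · exact mul_le_mul_of_nonneg_right (not_lt.1 h) (norm_nonneg _)

end MultiplicationOperators

/-! ### The range of the potential and the discrete spectrum of U - K -/

section EssentialRange

open scoped InnerProductSpace

theorem unitInterval_volume_pos {V : Set unitInterval} (hV : IsOpen V) (hne : V.Nonempty) :
    0 < (volume : Measure unitInterval) V := by
  obtain ⟨O, hO, rfl⟩ := isOpen_induced_iff.1 hV
  obtain ⟨x, hx⟩ := hne
  -- The point x may be an endpoint; density of (0, 1) moves it into the interior, where Lebesgue
  -- measure on ℝ applies.
  have hx' : (x : ℝ) ∈ closure (Set.Ioo (0 : ℝ) 1) := by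
    rw [closure_Ioo zero_ne_one]
    exact x.2
  have h1 : (O ∩ Set.Ioo (0 : ℝ) 1).Nonempty := mem_closure_iff.1 hx' O hO hx
  refine ((hO.inter isOpen_Ioo).measure_pos volume h1).trans_le ?_
  rw [unitInterval.volume_apply]
  refine measure_mono fun y hy => ⟨⟨y, hy.2.1.le, hy.2.2.le⟩, hy.1, rfl⟩

/-- An infinite Hausdorff space contains infinitely many disjoint nonempty open sets; here they have
positive measure, and their normalised indicators form the family. -/
theorem exists_orthonormal_supportedOn {N : Set unitInterval} (hN : IsOpen N)
    (hne : N.Nonempty) :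
    ∃ φ : ℕ → L2Interval, Orthonormal ℂ φ ∧ ∀ n, ∀ᵐ x, x ∉ N → φ n x = 0 := by
  obtain ⟨x₀, hx₀⟩ := hne
  have : Infinite N := (infinite_of_mem_nhds x₀ (hN.mem_nhds hx₀)).to_subtype
  obtain ⟨U, hUi, hUo, hUd⟩ := exists_seq_infinite_isOpen_pairwise_disjoint N
  let W : ℕ → Set unitInterval := fun n => Subtype.val '' U n
  have hWo : ∀ n, IsOpen (W n) := fun n => hN.isOpenMap_subtype_val _ (hUo n)
  have hWN : ∀ n, W n ⊆ N := fun n => by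
    rintro _ ⟨y, -, rfl⟩
    exact y.2
  have hWpos : ∀ n, volume (W n) ≠ 0 := fun n =>
    (unitInterval_volume_pos (hWo n) ((hUi n).nonempty.image _)).ne'
  have hWd : ∀ m n, m ≠ n → W m ∩ W n = ∅ := fun m n hmn =>
    Set.disjoint_iff_inter_eq_empty.1
      ((Set.disjoint_image_iff Subtype.val_injective).2 (hUd hmn))
  let f : ℕ → L2Interval := fun n =>
    indicatorConstLp 2 (hWo n).measurableSet (measure_ne_top volume (W n)) (1 : ℂ)
  have hf0 : ∀ n, f n ≠ 0 := fun n => by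
    rw [← norm_ne_zero_iff, norm_indicatorConstLp two_ne_zero ENNReal.ofNat_ne_top]
    have : 0 < volume.real (W n) := ENNReal.toReal_pos (hWpos n) (measure_ne_top _ _)
    rw [norm_one, one_mul]
    positivity
  refine ⟨fun n => ((‖f n‖⁻¹ : ℝ) : ℂ) • f n, ⟨fun n => ?_, fun m n hmn => ?_⟩, fun n => ?_⟩
  · rw [norm_smul, Complex.norm_real, norm_inv, norm_norm,
      inv_mul_cancel₀ (norm_ne_zero_iff.2 (hf0 n))]
  · change ⟪_ • f m, _ • f n⟫_ℂ = 0
    have h1 : ⟪f m, f n⟫_ℂ = 0 := by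
      rw [L2.inner_indicatorConstLp_indicatorConstLp, hWd m n hmn]
      simp
    rw [inner_smul_left, inner_smul_right, h1, mul_zero, mul_zero]
  · filter_upwards [Lp.coeFn_smul ((‖f n‖⁻¹ : ℝ) : ℂ) (f n),
      indicatorConstLp_coeFn_notMem (p := 2) (hs := (hWo n).measurableSet)
        (hμs := measure_ne_top volume (W n)) (c := (1 : ℂ))] with x h1 h2 hx
    rw [h1, Pi.smul_apply, h2 fun h => hx (hWN n h), smul_zero]

theorem friedrichsOp_apply (u : C(unitInterval, ℝ)) (k : C(unitInterval × unitInterval, ℂ))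
    (φ : L2Interval) : friedrichsOp u k φ = mulOp volume u φ - kernelOp k φ := rfl

/-- Values of `u` do not belong to the discrete spectrum of `U - K`. -/
theorem notMem_discreteSpectrum_friedrichsOp (u : C(unitInterval, ℝ))
    (k : C(unitInterval × unitInterval, ℂ)) (hk : IsSelfAdjoint (kernelOp k)) (x₀ : unitInterval) :
    (u x₀ : ℂ) ∉ discreteSpectrum (friedrichsOp u k) := by
  rintro ⟨-, hiso, -, hfin⟩
  obtain ⟨R, Q, hRQ, hQ⟩ :=
    ((mulOp_isSelfAdjoint u).sub hk).exists_inverse_mod_eigenspace hiso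
  have hfin' : FiniteDimensional ℂ (Module.End.eigenspace
      ((mulOp volume u - kernelOp k : L2Interval →L[ℂ] L2Interval) : L2Interval →ₗ[ℂ] L2Interval)
      (u x₀ : ℂ)) := hfin
  have hQc : IsCompactOperator Q :=
    isCompactOperator_of_forall_mem _ fun x => mem_eigenspace_clm.2 (hQ x)
  -- If u x₀ were in the discrete spectrum, then 1 = R(U - u x₀) + C with C compact.
  let C : L2Interval →L[ℂ] L2Interval := Q - R * kernelOp k
  have hC : IsCompactOperator C := hQc.sub ((isCompactOperator_kernelOp k).clm_comp R)
  -- With this ε, R(U - u x₀) has norm at most 1/2 on functions supported where |u - u x₀| < ε, so C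
  -- is bounded below by 1/2 on an infinite orthonormal family there and its differences.
  set ε : ℝ := (2 * (‖R‖ + 1))⁻¹
  have hε : 0 < ε := by positivity
  have hRε : ‖R‖ * ε ≤ 1 / 2 := by
    have : (‖R‖ + 1) * ε = 1 / 2 := by
      simp only [ε]
      field_simp
    nlinarith [norm_nonneg R]
  have hN : IsOpen {x | |u x - u x₀| < ε} := isOpen_lt (by fun_prop) continuous_const
  obtain ⟨φ, hφ, hsupp⟩ := exists_orthonormal_supportedOn hN ⟨x₀, by simpa using hε⟩
  refine not_isCompactOperator_of_orthonormal hφ (C := C) one_half_pos (fun m n => ?_) hC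
  set ψ := φ m - φ n
  have hψ : ∀ᵐ x, ε < |u x - u x₀| → ψ x = 0 := by
    filter_upwards [hsupp m, hsupp n, Lp.coeFn_sub (φ m) (φ n)] with x h1 h2 h3 hx
    have hx' : x ∉ {x | |u x - u x₀| < ε} := not_lt.2 hx.le
    rw [h3, Pi.sub_apply, h1 hx', h2 hx', sub_zero]
  have h1 := norm_mulOp_sub_le hψ
  have h2 : ψ = R (mulOp volume u ψ - (u x₀ : ℂ) • ψ) + C ψ := by
    have h3 := hRQ ψ
    have h4 : C ψ = Q ψ - R (kernelOp k ψ) := rfl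
    rw [h4, map_sub]
    rw [sub_apply, map_sub, map_sub] at h3
    linear_combination (norm := module) -h3
  have h3 : ‖ψ‖ ≤ ‖R‖ * (ε * ‖ψ‖) + ‖C ψ‖ := by
    calc ‖ψ‖ = ‖R (mulOp volume u ψ - (u x₀ : ℂ) • ψ) + C ψ‖ := by rw [← h2]
      _ ≤ ‖R (mulOp volume u ψ - (u x₀ : ℂ) • ψ)‖ + ‖C ψ‖ := norm_add_le _ _
      _ ≤ ‖R‖ * (ε * ‖ψ‖) + ‖C ψ‖ := by
        gcongr
        exact R.le_opNorm_of_le h1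
  nlinarith [norm_nonneg ψ]

/-- A point r ≥ 0 of the discrete spectrum would satisfy r ≤ max u because K ≥ 0. As u has a zero,
the intermediate value theorem makes r a value of u, which is excluded. So r < 0, and an eigenvector
at r makes the form negative. -/
theorem exists_isIsolatedBottom_friedrichsOp {u : C(unitInterval, ℝ)}
    {k : C(unitInterval × unitInterval, ℂ)} (hu : ∀ x, 0 ≤ u x) (hu₀ : ∃ x, u x = 0)
    (hK : (kernelOp k).IsPositive) (hne : (discreteSpectrum (friedrichsOp u k)).Nonempty) :
    ∃ a δ, IsIsolatedBottom (friedrichsOp u k) a δ := by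
  obtain ⟨z, hz⟩ := hne
  have hKs : IsSelfAdjoint (kernelOp k) := hK.isSelfAdjoint
  have hHs : IsSelfAdjoint (friedrichsOp u k) := (mulOp_isSelfAdjoint u).sub hKs
  obtain ⟨r, rfl⟩ : ∃ r : ℝ, z = r := ⟨z.re, hHs.mem_spectrum_eq_re hz.1⟩
  obtain ⟨φ, hφ, hφ0⟩ := hz.2.2.1.exists_hasEigenvector
  rw [mem_eigenspace_clm] at hφ
  have hpos : 0 < ‖φ‖ ^ 2 := pow_pos (norm_pos_iff.2 hφ0) 2
  have hre : (⟪friedrichsOp u k φ, φ⟫_ℂ).re = r * ‖φ‖ ^ 2 := by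
    rw [hφ, inner_smul_left, Complex.conj_ofReal, Complex.re_ofReal_mul, re_inner_self_complex]
  have hr : r < 0 := by
    by_contra! h0
    have h1 : r ≤ ‖u‖ := by
      have h2 : (⟪friedrichsOp u k φ, φ⟫_ℂ).re ≤ ‖u‖ * ‖φ‖ ^ 2 := by
        rw [friedrichsOp_apply, inner_sub_left, Complex.sub_re]
        have h3 : 0 ≤ (⟪kernelOp k φ, φ⟫_ℂ).re := hK.re_inner_nonneg_left φ
        linarith [mulOp_re_inner_le u φ]
      rw [hre] at h2
      exact le_of_mul_le_mul_right h2 hpos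
    obtain ⟨xm, -, hxm⟩ := isCompact_univ.exists_isMaxOn Set.univ_nonempty u.continuous.continuousOn
    have h2 : ‖u‖ ≤ u xm := (u.norm_le (hu xm)).2 fun x => by
      rw [Real.norm_eq_abs, abs_of_nonneg (hu x)]
      exact hxm (Set.mem_univ x)
    obtain ⟨x₁, hx₁⟩ := hu₀
    obtain ⟨x₀, hx₀⟩ := mem_range_of_exists_le_of_exists_ge u.continuous
      ⟨x₁, hx₁.trans_le h0⟩ ⟨xm, h1.trans h2⟩
    refine notMem_discreteSpectrum_friedrichsOp u k hKs x₀ ?_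
    rwa [hx₀]
  refine exists_isIsolatedBottom_sub (mulOp_isSelfAdjoint u) (mulOp_re_inner_nonneg hu) hKs
    (isCompactOperator_kernelOp k) ⟨φ, ?_⟩
  change (⟪friedrichsOp u k φ, φ⟫_ℂ).re < 0
  rw [hre]
  exact mul_neg_of_neg_of_pos hr hpos

end EssentialRange

/-! ### L₂ of the square as a tensor product -/

section SquareTensor

open scoped InnerProductSpace

theorem tensorFun_memLp (φ ψ : L2Interval) :
    MemLp (fun p : unitInterval × unitInterval => φ p.1 * ψ p.2) 2 := by
  have hm : AEStronglyMeasurable (fun p : unitInterval × unitInterval => φ p.1 * ψ p.2) :=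
    (Lp.aestronglyMeasurable φ).comp_fst.mul (Lp.aestronglyMeasurable ψ).comp_snd
  rw [memLp_two_iff_integrable_sq_norm hm]
  have h1 := (memLp_two_iff_integrable_sq_norm (Lp.aestronglyMeasurable φ)).1 (Lp.memLp φ)
  have h2 := (memLp_two_iff_integrable_sq_norm (Lp.aestronglyMeasurable ψ)).1 (Lp.memLp ψ)
  simp only [norm_mul, mul_pow]
  exact h1.mul_prod h2

/-- The function `(x, y) ↦ φ x * ψ y` in `L₂([0,1]²)`. -/
noncomputable def tensorFun (φ ψ : L2Interval) : L2Square := (tensorFun_memLp φ ψ).toLp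

theorem tensorFun_coeFn (φ ψ : L2Interval) :
    tensorFun φ ψ =ᵐ[volume] fun p => φ p.1 * ψ p.2 :=
  (tensorFun_memLp φ ψ).coeFn_toLp

theorem ae_fst {P : unitInterval → Prop} (h : ∀ᵐ x, P x) :
    ∀ᵐ p : unitInterval × unitInterval, P p.1 :=
  Measure.quasiMeasurePreserving_fst.ae h

theorem ae_snd {P : unitInterval → Prop} (h : ∀ᵐ x, P x) :
    ∀ᵐ p : unitInterval × unitInterval, P p.2 :=
  Measure.quasiMeasurePreserving_snd.ae h

theorem inner_tensorFun (φ φ' ψ ψ' : L2Interval) :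
    ⟪tensorFun φ ψ, tensorFun φ' ψ'⟫_ℂ = ⟪φ, φ'⟫_ℂ * ⟪ψ, ψ'⟫_ℂ := by
  rw [L2.inner_def, L2.inner_def, L2.inner_def, ← integral_prod_mul, ← Measure.volume_eq_prod]
  refine integral_congr_ae ?_
  filter_upwards [tensorFun_coeFn φ ψ, tensorFun_coeFn φ' ψ'] with p h1 h2
  rw [h1, h2]
  simp only [RCLike.inner_apply, map_mul]
  ring

theorem norm_tensorFun (φ ψ : L2Interval) : ‖tensorFun φ ψ‖ = ‖φ‖ * ‖ψ‖ := by
  have h := inner_tensorFun φ φ ψ ψ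
  simp only [inner_self_eq_norm_sq_to_K] at h
  have h' : ‖tensorFun φ ψ‖ ^ 2 = (‖φ‖ * ‖ψ‖) ^ 2 := by
    rw [mul_pow]
    exact_mod_cast h
  exact (sq_eq_sq₀ (norm_nonneg _) (by positivity)).1 h'

/-- The bilinear map `(φ, ψ) ↦ φ ⊗ ψ` from `L₂[0,1]` to `L₂([0,1]²)`. -/
noncomputable def tensorMap : L2Interval →L[ℂ] L2Interval →L[ℂ] L2Square :=
  LinearMap.mkContinuous₂
    (LinearMap.mk₂ ℂ tensorFun
      (fun φ φ' ψ => by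
        refine Lp.ext ?_
        filter_upwards [tensorFun_coeFn (φ + φ') ψ, tensorFun_coeFn φ ψ, tensorFun_coeFn φ' ψ,
          Lp.coeFn_add (tensorFun φ ψ) (tensorFun φ' ψ), ae_fst (Lp.coeFn_add φ φ')]
          with p h1 h2 h3 h4 h5
        rw [h1, h4, Pi.add_apply, h2, h3, h5, Pi.add_apply, add_mul])
      (fun c φ ψ => by
        refine Lp.ext ?_
        filter_upwards [tensorFun_coeFn (c • φ) ψ, tensorFun_coeFn φ ψ,
          Lp.coeFn_smul c (tensorFun φ ψ), ae_fst (Lp.coeFn_smul c φ)] with p h1 h2 h3 h4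
        rw [h1, h3, Pi.smul_apply, h2, h4, Pi.smul_apply, smul_mul_assoc])
      (fun φ ψ ψ' => by
        refine Lp.ext ?_
        filter_upwards [tensorFun_coeFn φ (ψ + ψ'), tensorFun_coeFn φ ψ, tensorFun_coeFn φ ψ',
          Lp.coeFn_add (tensorFun φ ψ) (tensorFun φ ψ'), ae_snd (Lp.coeFn_add ψ ψ')]
          with p h1 h2 h3 h4 h5
        rw [h1, h4, Pi.add_apply, h2, h3, h5, Pi.add_apply, mul_add])
      (fun c φ ψ => by
        refine Lp.ext ?_
        filter_upwards [tensorFun_coeFn φ (c • ψ), tensorFun_coeFn φ ψ,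
          Lp.coeFn_smul c (tensorFun φ ψ), ae_snd (Lp.coeFn_smul c ψ)] with p h1 h2 h3 h4
        rw [h1, h3, Pi.smul_apply, h2, h4, Pi.smul_apply, mul_smul_comm]))
    1 fun φ ψ => by
      rw [one_mul]
      exact (norm_tensorFun φ ψ).le

theorem tensorMap_apply (φ ψ : L2Interval) : tensorMap φ ψ = tensorFun φ ψ := rfl

/-- For totality: the functional ⟪f, ·⟫ vanishes on separated continuous functions, hence on all
continuous functions by Stone–Weierstrass, hence everywhere by their density in L₂. -/
theorem isHilbertTensor_tensorMap : IsHilbertTensor tensorMap where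
  inner_apply φ φ' ψ ψ' := inner_tensorFun φ φ' ψ ψ'
  total f hf := by
    let T : C(unitInterval × unitInterval, ℂ) →L[ℂ] L2Square := ContinuousMap.toLp 2 volume ℂ
    have hT : DenseRange T := ContinuousMap.toLp_denseRange ℂ volume ℂ ENNReal.ofNat_ne_top
    let L : C(unitInterval × unitInterval, ℂ) →L[ℂ] ℂ := innerSL ℂ f ∘L T
    have hL : LinearMap.ker (L : C(unitInterval × unitInterval, ℂ) →ₗ[ℂ] ℂ) = ⊤ := by
      refine eq_top_of_prodFun_mem _ L.isClosed_ker fun g h => ?_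
      change ⟪f, T (prodFun g h)⟫_ℂ = 0
      let gL : L2Interval := ContinuousMap.toLp 2 volume ℂ g
      let hL : L2Interval := ContinuousMap.toLp 2 volume ℂ h
      have h1 : T (prodFun g h) = tensorFun gL hL := by
        refine Lp.ext ?_
        filter_upwards [ContinuousMap.coeFn_toLp (p := 2) (𝕜 := ℂ) volume (prodFun g h),
          tensorFun_coeFn gL hL,
          ae_fst (ContinuousMap.coeFn_toLp (p := 2) (𝕜 := ℂ) volume g),
          ae_snd (ContinuousMap.coeFn_toLp (p := 2) (𝕜 := ℂ) volume h)] with p h1 h2 h3 h4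
        rw [h1, h2, h3, h4]
        rfl
      rw [h1, ← inner_conj_symm, ← tensorMap_apply, hf, map_zero]
    have h2 : ⇑(innerSL ℂ f) = fun _ => (0 : ℂ) :=
      hT.equalizer (innerSL ℂ f).continuous continuous_const <| funext fun k => by
        have : k ∈ LinearMap.ker (L : C(unitInterval × unitInterval, ℂ) →ₗ[ℂ] ℂ) := by
          rw [hL]
          trivial
        exact this
    exact inner_self_eq_zero.1 (congrFun h2 f)

theorem kernelOpFst_tensorMap (k : C(unitInterval × unitInterval, ℂ)) (φ ψ : L2Interval) :
    kernelOpFst k (tensorMap φ ψ) = tensorMap (kernelOp k φ) ψ := by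
  refine Lp.ext ?_
  have h0 : kernelOpFst k (tensorMap φ ψ) =ᵐ[volume] kernelFunFst k (tensorMap φ ψ) :=
    (kernelFunFst_memLp k (Lp.memLp (tensorMap φ ψ))).coeFn_toLp
  filter_upwards [h0, kernelFunFst_congr k (tensorFun_coeFn φ ψ),
    tensorFun_coeFn (kernelOp k φ) ψ, ae_fst (kernelOp_coeFn k φ)] with p h1 h2 h3 h4
  rw [h1, tensorMap_apply, h2, tensorMap_apply, h3, h4]
  simp only [kernelFunFst, kernelFun]
  rw [← integral_mul_const]
  simp only [mul_assoc]

theorem kernelOpSnd_tensorMap (k : C(unitInterval × unitInterval, ℂ)) (φ ψ : L2Interval) :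
    kernelOpSnd k (tensorMap φ ψ) = tensorMap φ (kernelOp k ψ) := by
  refine Lp.ext ?_
  have h0 : kernelOpSnd k (tensorMap φ ψ) =ᵐ[volume] kernelFunSnd k (tensorMap φ ψ) :=
    (kernelFunSnd_memLp k (Lp.memLp (tensorMap φ ψ))).coeFn_toLp
  filter_upwards [h0, kernelFunSnd_congr k (tensorFun_coeFn φ ψ),
    tensorFun_coeFn φ (kernelOp k ψ), ae_snd (kernelOp_coeFn k ψ)] with p h1 h2 h3 h4
  rw [h1, tensorMap_apply, h2, tensorMap_apply, h3, h4]
  simp only [kernelFunSnd, kernelFun]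
  rw [← integral_const_mul]
  simp only [mul_left_comm]

theorem mulOp_fst_tensorMap (u : C(unitInterval, ℝ)) (φ ψ : L2Interval) :
    mulOp volume (u.comp ContinuousMap.fst) (tensorMap φ ψ) =
      tensorMap (mulOp volume u φ) ψ := by
  refine Lp.ext ?_
  filter_upwards [mulOp_coeFn (u.comp ContinuousMap.fst) (tensorMap φ ψ), tensorFun_coeFn φ ψ,
    tensorFun_coeFn (mulOp volume u φ) ψ, ae_fst (mulOp_coeFn u φ)] with p h1 h2 h3 h4
  rw [h1, tensorMap_apply, h2, tensorMap_apply, h3, h4, mul_assoc]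
  rfl

theorem mulOp_snd_tensorMap (v : C(unitInterval, ℝ)) (φ ψ : L2Interval) :
    mulOp volume (v.comp ContinuousMap.snd) (tensorMap φ ψ) =
      tensorMap φ (mulOp volume v ψ) := by
  refine Lp.ext ?_
  filter_upwards [mulOp_coeFn (v.comp ContinuousMap.snd) (tensorMap φ ψ), tensorFun_coeFn φ ψ,
    tensorFun_coeFn φ (mulOp volume v ψ), ae_snd (mulOp_coeFn v ψ)] with p h1 h2 h3 h4
  rw [h1, tensorMap_apply, h2, tensorMap_apply, h3, h4, mul_left_comm]
  rfl

theorem mulOp_sumPotential (u v : C(unitInterval, ℝ)) :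
    mulOp (volume : Measure (unitInterval × unitInterval)) (sumPotential u v) =
      mulOp volume (u.comp ContinuousMap.fst) + mulOp volume (v.comp ContinuousMap.snd) := by
  ext1 f
  refine Lp.ext ?_
  rw [add_apply]
  filter_upwards [mulOp_coeFn (sumPotential u v) f, mulOp_coeFn (u.comp ContinuousMap.fst) f,
    mulOp_coeFn (v.comp ContinuousMap.snd) f, Lp.coeFn_add
      (mulOp volume (u.comp ContinuousMap.fst) f) (mulOp volume (v.comp ContinuousMap.snd) f)]
    with p h1 h2 h3 h4
  rw [h1, h4, Pi.add_apply, h2, h3, ← add_mul, ← Complex.ofReal_add]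
  rfl

/-- `friedrichsOp u k ⊗ 1`. -/
noncomputable def friedrichsOpFst (u : C(unitInterval, ℝ))
    (k : C(unitInterval × unitInterval, ℂ)) : L2Square →L[ℂ] L2Square :=
  mulOp volume (u.comp ContinuousMap.fst) - kernelOpFst k

/-- `1 ⊗ friedrichsOp v k`. -/
noncomputable def friedrichsOpSnd (v : C(unitInterval, ℝ))
    (k : C(unitInterval × unitInterval, ℂ)) : L2Square →L[ℂ] L2Square :=
  mulOp volume (v.comp ContinuousMap.snd) - kernelOpSnd k

theorem friedrichsOpFst_tensorMap (u : C(unitInterval, ℝ))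
    (k : C(unitInterval × unitInterval, ℂ)) (φ ψ : L2Interval) :
    friedrichsOpFst u k (tensorMap φ ψ) = tensorMap (friedrichsOp u k φ) ψ := by
  rw [friedrichsOpFst, sub_apply, mulOp_fst_tensorMap, kernelOpFst_tensorMap, friedrichsOp_apply,
    map_sub, sub_apply]

theorem friedrichsOpSnd_tensorMap (v : C(unitInterval, ℝ))
    (k : C(unitInterval × unitInterval, ℂ)) (φ ψ : L2Interval) :
    friedrichsOpSnd v k (tensorMap φ ψ) = tensorMap φ (friedrichsOp v k ψ) := by
  rw [friedrichsOpSnd, sub_apply, mulOp_snd_tensorMap, kernelOpSnd_tensorMap, friedrichsOp_apply,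
    map_sub]

theorem threeParticleOp_eq_add (u v : C(unitInterval, ℝ))
    (k₁ k₂ : C(unitInterval × unitInterval, ℂ)) :
    threeParticleOp u v k₁ k₂ = friedrichsOpFst u k₁ + friedrichsOpSnd v k₂ := by
  rw [threeParticleOp, mulOp_sumPotential, friedrichsOpFst, friedrichsOpSnd]
  abel

end SquareTensor

/-! ### The main theorem -/

theorem mainTheorem10 (u v : C(unitInterval, ℝ))
    (k₁ k₂ : C(unitInterval × unitInterval, ℂ))
    (hu : ∀ x, 0 ≤ u x) (hv : ∀ x, 0 ≤ v x)
    (hu₀ : ∃ x, u x = 0) (hv₀ : ∃ x, v x = 0)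
    (hk₁ : ∀ x s, k₁ (x, s) = starRingEnd ℂ (k₁ (s, x)))
    (hk₂ : ∀ x s, k₂ (x, s) = starRingEnd ℂ (k₂ (s, x)))
    (hK₁ : (kernelOp k₁).IsPositive) (hK₂ : (kernelOp k₂).IsPositive) :
    ((discreteSpectrum (friedrichsOp u k₁) = ∅ ∨ discreteSpectrum (friedrichsOp v k₂) = ∅) →
      discreteSpectrum (threeParticleOp u v k₁ k₂) = ∅) ∧
    ((discreteSpectrum (friedrichsOp u k₁)).Nonempty →
      (discreteSpectrum (friedrichsOp v k₂)).Nonempty →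
      (discreteSpectrum (threeParticleOp u v k₁ k₂)).Nonempty) ∧
    (∀ p q : Cardinal, Cardinal.mk (discreteSpectrum (friedrichsOp u k₁)) = p →
      Cardinal.mk (discreteSpectrum (friedrichsOp v k₂)) = q →
      Cardinal.mk (discreteSpectrum (threeParticleOp u v k₁ k₂)) ≤ p * q) := by
  have hJ := isHilbertTensor_tensorMap
  have hX : IsSelfAdjoint (friedrichsOp u k₁) := (mulOp_isSelfAdjoint u).sub hK₁.isSelfAdjoint
  have hY : IsSelfAdjoint (friedrichsOp v k₂) := (mulOp_isSelfAdjoint v).sub hK₂.isSelfAdjoint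
  have hA := friedrichsOpFst_tensorMap u k₁
  have hB := friedrichsOpSnd_tensorMap v k₂
  rw [threeParticleOp_eq_add]
  have key : ∀ z ∈ discreteSpectrum (friedrichsOpFst u k₁ + friedrichsOpSnd v k₂),
      ∃ a ∈ discreteSpectrum (friedrichsOp u k₁), ∃ b ∈ discreteSpectrum (friedrichsOp v k₂),
        a + b = z := fun z hz => hJ.exists_add_of_mem_discreteSpectrum hX hY hA hB hz
  refine ⟨fun h => ?_, fun h₁ h₂ => ?_, ?_⟩
  · refine Set.eq_empty_of_forall_notMem fun z hz => ?_
    obtain ⟨a, ha, b, hb, -⟩ := key z hz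
    rcases h with h | h
    · rwa [h] at ha
    · rwa [h] at hb
  · obtain ⟨a, δ, ha⟩ := exists_isIsolatedBottom_friedrichsOp hu hu₀ hK₁ h₁
    obtain ⟨b, δ', hb⟩ := exists_isIsolatedBottom_friedrichsOp hv hv₀ hK₂ h₂
    have hB' : ∀ ψ φ, friedrichsOpSnd v k₂ (tensorMap.flip ψ φ) =
        tensorMap.flip (friedrichsOp v k₂ ψ) φ := fun ψ φ => hB φ ψ
    exact ⟨_, (hJ.isIsolatedBottom_add hX hY hA hB ha hb).mem_discreteSpectrum
      ((hJ.isSelfAdjoint hX hA).add (hJ.flip.isSelfAdjoint hY hB'))⟩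
  · rintro p q rfl rfl
    rw [Cardinal.mul_def]
    -- Choosing one decomposition z = a + b for each z is injective into the product, because the
    -- pair determines its sum.
    choose! f hf g hg hfg using key
    refine Cardinal.mk_le_of_injective (f := fun z : discreteSpectrum
      (friedrichsOpFst u k₁ + friedrichsOpSnd v k₂) =>
        ((⟨f z, hf z z.2⟩, ⟨g z, hg z z.2⟩) :
          discreteSpectrum (friedrichsOp u k₁) × discreteSpectrum (friedrichsOp v k₂))) ?_
    intro z w hzw
    simp only [Prod.mk.injEq, Subtype.mk.injEq] at hzw
    rw [Subtype.ext_iff, ← hfg z z.2, ← hfg w w.2, hzw.1, hzw.2]
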